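/- For finite sets $P,W$ of points in the plane, the \emph{witness Delaunay graph} $DG^{-}(P,W)$ is the graph with vertex set $P$ in which two distinct points $x,y\in P$ are adjacent if and only if there is an open disk that contains no point of $W$ and whose bounding circle passes through $x$ and $y$. A point set is \emph{in general position} if no three distinct points of it are collinear and no four distinct points of it are concyclic. \textbf{Theorem.} (1) For every finite tree $T$ there are finite point sets $P$ and $W$ in the plane such that $P\cup W$ is in general position and $DG^{-}(P,W)$ is isomorphic to $T$. (2) Such a realization can be computed in time linear in the size of the tree, in the infinite-precision-arithmetic model of computation. That is, there are a program for a random access machine with exact real arithmetic and a constant $C$ such that, for every $n$ and every tree $T$ with vertex set $\{0,\dots,n-1\}$, the program, given $n$ and a list of the edges of $T$ in any order, halts after at most $Cn$ steps and outputs points $p_0,\dots,p_{n-1}$ and a list of points forming a set $W$ such that, with $P=\{p_0,\dots,p_{n-1}\}$, the set $P\cup W$ is in general position and $v\mapsto p_v$ is an isomorphism from $T$ to $DG^{-}(P,W)$ (in particular, the points $p_v$ are distinct). Here the machine stores natural numbers and exact real numbers in finitely many variables and finitely many arrays, the array entries being addressed by computed natural numbers; all memory other than the input is initially zero. One step is a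 constant (a natural number, or a rational number as a real constant), a memory access, an addition, truncated subtraction or comparison of natural numbers, or an addition, subtraction, multiplication, division (by a nonzero number) or comparison of real numbers; programs are built from assignments by sequencing, branching on comparisons and while-loops. -/

import Mathlib

/-! ### Witness Delaunay graphs -/

/-- The Euclidean plane. -/
abbrev Plane : Type := EuclideanSpace ℝ (Fin 2)

/-- The (negative) witness Delaunay graph `DG⁻(P, W)`: its vertices are the points of `P`, and two
distinct points are adjacent when some open disk whose bounding circle passes through both of
them contains no point of `W`. -/
def witnessDelaunay (P W : Set Plane) : SimpleGraph P where
  Adj x y := x ≠ y ∧ ∃ (c : Plane) (r : ℝ),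
    (x : Plane) ∈ Metric.sphere c r ∧ (y : Plane) ∈ Metric.sphere c r ∧
      ∀ w ∈ W, w ∉ Metric.ball c r
  symm := ⟨fun _ _ ⟨hne, c, r, hx, hy, hW⟩ => ⟨hne.symm, c, r, hy, hx, hW⟩⟩
  loopless := ⟨fun _ h => h.1 rfl⟩

/-- No three distinct points of `S` are collinear and no four distinct points of `S` are
concyclic. -/
def InGeneralPosition (S : Set Plane) : Prop :=
  (∀ a ∈ S, ∀ b ∈ S, ∀ c ∈ S, a ≠ b → a ≠ c → b ≠ c → ¬ Collinear ℝ ({a, b, c} : Set Plane)) ∧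
  (∀ a ∈ S, ∀ b ∈ S, ∀ c ∈ S, ∀ d ∈ S,
    a ≠ b → a ≠ c → a ≠ d → b ≠ c → b ≠ d → c ≠ d →
      ¬ EuclideanGeometry.Concyclic ({a, b, c, d} : Set Plane))

/-! ### The infinite-precision-arithmetic model: a random access machine with exact reals

The memory holds natural numbers (used for counting and for addressing) and exact real numbers.
Both kinds of data live in variables and in arrays; variables and arrays are named by numerals
occurring in the program, so a program uses only finitely many of them, while array entries are
addressed by computed natural numbers. The operations on natural numbers are addition, truncated
subtraction and comparison; those on real numbers are the four arithmetic operations and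
comparison. There is no root extraction, no rounding, no conversion between the two kinds of
numbers, and the only real constants are rational. Each constant, memory access, operation and
comparison costs one step. -/
namespace RealRAM

/-- The contents of the memory. -/
structure State where
  /-- the natural number variables -/
  nvar : ℕ → ℕ
  /-- the natural number arrays: `narr a i` is entry `i` of array `a` -/
  narr : ℕ → ℕ → ℕ
  /-- the real variables -/
  rvar : ℕ → ℝ
  /-- the real arrays: `rarr a i` is entry `i` of array `a` -/
  rarr : ℕ → ℕ → ℝ

/-- Expressions with natural number values. -/
inductive NatExpr where
  | lit (k : ℕ)
  | var (x : ℕ)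
  | get (a : ℕ) (i : NatExpr)
  | add (e f : NatExpr)
  | sub (e f : NatExpr)

/-- The value of an expression; subtraction is truncated at zero. -/
def NatExpr.eval (s : State) : NatExpr → ℕ
  | lit k => k
  | var x => s.nvar x
  | get a i => s.narr a (i.eval s)
  | add e f => e.eval s + f.eval s
  | sub e f => e.eval s - f.eval s

/-- The number of steps needed to evaluate an expression. -/
def NatExpr.cost : NatExpr → ℕ
  | lit _ => 1
  | var _ => 1
  | get _ i => i.cost + 1
  | add e f => e.cost + f.cost + 1
  | sub e f => e.cost + f.cost + 1

/-- Expressions with real values (division is a separate instruction). -/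
inductive RealExpr where
  | lit (q : ℚ)
  | var (x : ℕ)
  | get (a : ℕ) (i : NatExpr)
  | add (e f : RealExpr)
  | sub (e f : RealExpr)
  | mul (e f : RealExpr)

/-- The exact value of a real expression. -/
def RealExpr.eval (s : State) : RealExpr → ℝ
  | lit q => (q : ℝ)
  | var x => s.rvar x
  | get a i => s.rarr a (i.eval s)
  | add e f => e.eval s + f.eval s
  | sub e f => e.eval s - f.eval s
  | mul e f => e.eval s * f.eval s

/-- The number of steps needed to evaluate a real expression. -/
def RealExpr.cost : RealExpr → ℕ
  | lit _ => 1
  | var _ => 1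
  | get _ i => i.cost + 1
  | add e f => e.cost + f.cost + 1
  | sub e f => e.cost + f.cost + 1
  | mul e f => e.cost + f.cost + 1

/-- The tests on which a program can branch. -/
inductive Test where
  | natEq (e f : NatExpr)
  | natLt (e f : NatExpr)
  | realEq (e f : RealExpr)
  | realLt (e f : RealExpr)

/-- The outcome of a test. -/
def Test.Holds (s : State) : Test → Prop
  | natEq e f => e.eval s = f.eval s
  | natLt e f => e.eval s < f.eval s
  | realEq e f => e.eval s = f.eval s
  | realLt e f => e.eval s < f.eval s

/-- The number of steps needed to perform a test. -/
def Test.cost : Test → ℕ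
  | natEq e f => e.cost + f.cost + 1
  | natLt e f => e.cost + f.cost + 1
  | realEq e f => e.cost + f.cost + 1
  | realLt e f => e.cost + f.cost + 1

/-- Programs. -/
inductive Program where
  | skip
  /-- assign to the natural number variable `x` -/
  | setNat (x : ℕ) (e : NatExpr)
  /-- assign to entry `i` of the natural number array `a` -/
  | putNat (a : ℕ) (i e : NatExpr)
  /-- assign to the real variable `x` -/
  | setReal (x : ℕ) (e : RealExpr)
  /-- assign to entry `i` of the real array `a` -/
  | putReal (a : ℕ) (i : NatExpr) (e : RealExpr)
  /-- assign the quotient `e / f` to the real variable `x` -/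
  | setDiv (x : ℕ) (e f : RealExpr)
  /-- run `p`, then `q` -/
  | seq (p q : Program)
  /-- run `p` if the test succeeds, otherwise `q` -/
  | branch (b : Test) (p q : Program)
  /-- run `p` again and again as long as the test succeeds -/
  | loop (b : Test) (p : Program)

/-- `Runs p s t s'`: started on the memory `s`, the program `p` halts after exactly `t` steps and
leaves the memory `s'`. A program that attempts to divide by zero has no run. -/
inductive Runs : Program → State → ℕ → State → Prop where
  | skip (s : State) : Runs .skip s 1 s
  | setNat (s : State) (x : ℕ) (e : NatExpr) :
      Runs (.setNat x e) s (e.cost + 1)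
        { s with nvar := Function.update s.nvar x (e.eval s) }
  | putNat (s : State) (a : ℕ) (i e : NatExpr) :
      Runs (.putNat a i e) s (i.cost + e.cost + 1)
        { s with narr :=
            Function.update s.narr a (Function.update (s.narr a) (i.eval s) (e.eval s)) }
  | setReal (s : State) (x : ℕ) (e : RealExpr) :
      Runs (.setReal x e) s (e.cost + 1)
        { s with rvar := Function.update s.rvar x (e.eval s) }
  | putReal (s : State) (a : ℕ) (i : NatExpr) (e : RealExpr) :
      Runs (.putReal a i e) s (i.cost + e.cost + 1)
        { s with rarr :=
            Function.update s.rarr a (Function.update (s.rarr a) (i.eval s) (e.eval s)) }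
  | setDiv (s : State) (x : ℕ) (e f : RealExpr) (hf : f.eval s ≠ 0) :
      Runs (.setDiv x e f) s (e.cost + f.cost + 2)
        { s with rvar := Function.update s.rvar x (e.eval s / f.eval s) }
  | seq {p q : Program} {s s' s'' : State} {t t' : ℕ}
      (hp : Runs p s t s') (hq : Runs q s' t' s'') : Runs (.seq p q) s (t + t') s''
  | branchTrue {b : Test} {p q : Program} {s s' : State} {t : ℕ}
      (hb : b.Holds s) (hp : Runs p s t s') : Runs (.branch b p q) s (b.cost + t) s'
  | branchFalse {b : Test} {p q : Program} {s s' : State} {t : ℕ}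
      (hb : ¬ b.Holds s) (hq : Runs q s t s') : Runs (.branch b p q) s (b.cost + t) s'
  | loopDone {b : Test} {p : Program} {s : State}
      (hb : ¬ b.Holds s) : Runs (.loop b p) s b.cost s
  | loopStep {b : Test} {p : Program} {s s' s'' : State} {t t' : ℕ}
      (hb : b.Holds s) (hp : Runs p s t s') (hl : Runs (.loop b p) s' t' s'') :
      Runs (.loop b p) s (b.cost + t + t') s''

end RealRAM

/-! ### Input and output -/

/-- `L` lists every edge of `G` exactly once, in an arbitrary order, each with its two endpoints
in an arbitrary order. -/
def IsEdgeList {n : ℕ} (G : SimpleGraph (Fin n)) (L : List (Fin n × Fin n)) : Prop :=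
  (L.map fun e => s(e.1, e.2)).Nodup ∧
    ∀ e : Sym2 (Fin n), (e ∈ L.map fun e => s(e.1, e.2)) ↔ e ∈ G.edgeSet

/-- The initial memory for a graph with vertices `0, …, n - 1` and edge list `L`: variable `0`
holds `n`, entry `i` of the arrays `0` and `1` holds the first and the second endpoint of the `i`-th
edge of `L`, and everything else is zero. -/
def inputState (n : ℕ) (L : List (Fin n × Fin n)) : RealRAM.State where
  nvar x := if x = 0 then n else 0
  narr a i :=
    if a = 0 then (L[i]?).elim 0 (fun e => (e.1 : ℕ))
    else if a = 1 then (L[i]?).elim 0 (fun e => (e.2 : ℕ))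
    else 0
  rvar _ := 0
  rarr _ _ := 0

/-- The location of vertex `v` in the output: its coordinates are entry `v` of the real arrays `0`
and `1`. -/
noncomputable def outputVertex (s : RealRAM.State) (v : ℕ) : Plane :=
  !₂[s.rarr 0 v, s.rarr 1 v]

/-- The set of witnesses in the output: their number (with repetitions allowed) is the value of
the natural number variable `0`, and their coordinates are the entries of the real arrays `2`
and `3`. -/
noncomputable def outputWitnesses (s : RealRAM.State) : Set Plane :=
  {w | ∃ j < s.nvar 0, w = !₂[s.rarr 2 j, s.rarr 3 j]}

/-! ### General position and grids -/

/-! The tree is grown from one vertex by attaching leaves, each with three private witnesses, at a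
scale far below that of everything placed before. Before a step all points lie on a grid of width
`δ`; put `t = δ ^ 2` and let `J` be the quarter turn. A leaf attached at `x` goes to `y = x + v`
with `v` about `(t ^ 3, -t ^ 2)`, almost straight below `x`, and its witnesses go near `y + p • v +
k • t • J v` for three pairs `(p, k)`.

Those pairs serve two opposite ends. The disk for the new edge has centre `x + v / 2 + J v / t`; in
the coordinates `(p, k)` around `y` it is, to leading order, the region `p ^ 2 + p < 2 * k`, and the
three pairs lie outside it (`outside_leaf_disk`). Yet the origin is interior to their triangle, so a
circle through `y` with all three witnesses outside must have its centre within `O(t)` of `y`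
(`center_near_of_outside`). Such a circle is too small to reach any old vertex except `x`, whence
`y` has no neighbour but `x`.

Old nonedges keep their witnesses. For old edges the invariant `Realizes` asks for a disk whose
centre is a grid point higher than both ends and which is strictly empty of all other points,
vertices included. If the disk passes through `x`, the new points lie below `x` and so fall outside
(`JustBelow.sqDist_lt`). Otherwise `x` is outside by at least `δ ^ 2` in squared distance, since
squared distances on the grid are multiples of `δ ^ 2`, while the new points change this by only
`O(δ ^ 4)`. The slight tilt of `v` makes the new centre higher than `x` too, so the invariant
reproduces itself (`Realizes.attach`).

General position comes from adding `(δ ^ 5, δ ^ 10)` to a grid point: the determinants become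
polynomials in `δ ^ 5` with coefficients on a coarser grid, so the lowest nonzero term dominates
(`GenPos.insert_near`). After a step the grid is refined to a fixed power of `δ`, which costs
boundedly many exact operations.

For linear time the machine keeps for every vertex its degree and the sum of its neighbours. For a
leaf that sum is its neighbour, so leaves can be stripped without adjacency lists. A pointer sweeps
the vertices once, following each removed leaf to its neighbour; replaying the removals backwards
attaches the leaves. -/

/-- Twice the signed area of the triangle `abc`. -/
def orient (a b c : ℝ × ℝ) : ℝ := (b.1 - a.1) * (c.2 - a.2) - (b.2 - a.2) * (c.1 - a.1)

/-- The in-circle determinant of four points. -/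
def incirc (a b c q : ℝ × ℝ) : ℝ :=
  orient a b c * ((q.1 - a.1) ^ 2 + (q.2 - a.2) ^ 2)
    - ((c.1 - a.1) ^ 2 + (c.2 - a.2) ^ 2) * orient a b q
    + ((b.1 - a.1) ^ 2 + (b.2 - a.2) ^ 2) * orient a c q

/-- General position, in terms of determinants. -/
structure GenPos (S : Set (ℝ × ℝ)) : Prop where
  line : ∀ a ∈ S, ∀ b ∈ S, ∀ c ∈ S, a ≠ b → a ≠ c → b ≠ c → orient a b c ≠ 0
  circle : ∀ a ∈ S, ∀ b ∈ S, ∀ c ∈ S, ∀ d ∈ S,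
    a ≠ b → a ≠ c → a ≠ d → b ≠ c → b ≠ d → c ≠ d → incirc a b c d ≠ 0

/-- `δ` is the reciprocal of a large multiple of `16`. -/
def UnitFrac (δ : ℝ) : Prop := ∃ N : ℕ, 1000000 ≤ N ∧ 16 ∣ N ∧ δ * N = 1

/-- `x` is an integral multiple of `δ`. -/
def OnGrid (δ x : ℝ) : Prop := ∃ i : ℤ, x = i * δ

/-- A point of the grid of width `δ` that lies well inside the square `[-1, 1]²`. -/
structure GridPoint (δ : ℝ) (a : ℝ × ℝ) : Prop where
  fst : OnGrid δ a.1
  snd : OnGrid δ a.2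
  fst_le : |a.1| + δ ≤ 1
  snd_le : |a.2| + δ ≤ 1

namespace UnitFrac

variable {δ : ℝ}

lemma pos (h : UnitFrac δ) : 0 < δ := by
  obtain ⟨N, -, -, h⟩ := h
  by_contra hδ
  have : δ * N ≤ 0 := mul_nonpos_of_nonpos_of_nonneg (not_lt.1 hδ) (Nat.cast_nonneg N)
  linarith

lemma le (h : UnitFrac δ) : 1000000 * δ ≤ 1 := by
  have h0 := h.pos
  obtain ⟨N, hN, -, h⟩ := h
  have : (1000000 : ℝ) ≤ N := by exact_mod_cast hN
  nlinarith

lemma pow (h : UnitFrac δ) {k : ℕ} (hk : k ≠ 0) : UnitFrac (δ ^ k) := by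
  obtain ⟨N, hN, h16, h⟩ := h
  refine ⟨N ^ k, hN.trans (Nat.le_self_pow hk N), h16.trans (dvd_pow_self N hk), ?_⟩
  rw [Nat.cast_pow, ← mul_pow, h, one_pow]

lemma pow_lt_pow (h : UnitFrac δ) (j : ℕ) : 1000000 * δ ^ (j + 1) ≤ δ ^ j := by
  have := mul_le_mul_of_nonneg_left h.le (pow_pos h.pos j).le
  rw [pow_succ]; linarith

lemma pow_le (h : UnitFrac δ) {j k : ℕ} (hjk : j ≤ k) : δ ^ k ≤ δ ^ j :=
  pow_le_pow_of_le_one h.pos.le (by linarith [h.le, h.pos]) hjk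

end UnitFrac

namespace OnGrid

variable {δ ε x y : ℝ}

lemma add (hx : OnGrid δ x) (hy : OnGrid δ y) : OnGrid δ (x + y) := by
  obtain ⟨i, rfl⟩ := hx
  obtain ⟨j, rfl⟩ := hy
  exact ⟨i + j, by push_cast; ring⟩

lemma sub (hx : OnGrid δ x) (hy : OnGrid δ y) : OnGrid δ (x - y) := by
  obtain ⟨i, rfl⟩ := hx
  obtain ⟨j, rfl⟩ := hy
  exact ⟨i - j, by push_cast; ring⟩

lemma neg (hx : OnGrid δ x) : OnGrid δ (-x) := by
  obtain ⟨i, rfl⟩ := hx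
  exact ⟨-i, by push_cast; ring⟩

lemma mul (hx : OnGrid δ x) (hy : OnGrid ε y) : OnGrid (δ * ε) (x * y) := by
  obtain ⟨i, rfl⟩ := hx
  obtain ⟨j, rfl⟩ := hy
  exact ⟨i * j, by push_cast; ring⟩

lemma zsmul (hx : OnGrid δ x) (k : ℤ) : OnGrid δ (k * x) := by
  obtain ⟨i, rfl⟩ := hx
  exact ⟨k * i, by push_cast; ring⟩

lemma zero (δ : ℝ) : OnGrid δ 0 := ⟨0, by simp⟩

lemma self (δ : ℝ) : OnGrid δ δ := ⟨1, by simp⟩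

lemma trans (hx : OnGrid δ x) (h : OnGrid ε δ) : OnGrid ε x := by
  obtain ⟨i, rfl⟩ := hx
  exact h.zsmul i

lemma pow_pow (h : UnitFrac δ) {j k : ℕ} (hjk : j ≤ k) : OnGrid (δ ^ k) (δ ^ j) := by
  obtain ⟨N, -, -, h⟩ := h
  obtain ⟨m, rfl⟩ := Nat.exists_eq_add_of_le hjk
  refine ⟨(N : ℤ) ^ m, ?_⟩
  have : δ ^ m * (N : ℝ) ^ m = 1 := by rw [← mul_pow, h, one_pow]
  push_cast
  rw [pow_add]
  linear_combination (-δ ^ j) * this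

lemma finer {j k : ℕ} (hx : OnGrid (δ ^ j) x) (h : UnitFrac δ) (hjk : j ≤ k) :
    OnGrid (δ ^ k) x :=
  hx.trans (pow_pow h hjk)

lemma div_sixteen (h : UnitFrac δ) : OnGrid δ (1 / 16) := by
  obtain ⟨N, -, ⟨M, rfl⟩, h⟩ := h
  refine ⟨M, ?_⟩
  push_cast at h ⊢
  linear_combination (-1 / 16) * h

lemma le_abs (hx : OnGrid δ x) (hδ : 0 < δ) (h : x ≠ 0) : δ ≤ |x| := by
  obtain ⟨i, rfl⟩ := hx
  have hi : i ≠ 0 := by rintro rfl; simp at h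
  have : (1 : ℝ) ≤ |(i : ℝ)| := by exact_mod_cast Int.one_le_abs hi
  rw [abs_mul, abs_of_pos hδ]
  nlinarith

end OnGrid

/-! ### Perturbing a grid point into general position. -/

section Extend

variable {δ : ℝ}

/-- A sparse polynomial in `δ ^ 5` with coefficients on the grid of width `δ ^ 4`. -/
lemma sparse_poly_ne_zero (h : UnitFrac δ) {g : Fin 4 → ℝ} (hg : ∀ i, OnGrid (δ ^ 4) (g i))
    (hb : ∀ i, |g i| ≤ 200) (hne : ∃ i, g i ≠ 0) :
    g 0 + g 1 * δ ^ 5 + g 2 * δ ^ 10 + g 3 * δ ^ 20 ≠ 0 := by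
  have h4 : 0 < δ ^ 4 := pow_pos h.pos 4
  have key : ∀ i, g i ≠ 0 → δ ^ 4 ≤ |g i| := fun i hi => (hg i).le_abs h4 hi
  have h5 : 1000000 * δ ^ 5 ≤ δ ^ 4 := h.pow_lt_pow 4
  have h51 : δ ^ 5 ≤ 1 := by simpa using h.pow_le (Nat.zero_le 5)
  have h5p : 0 < δ ^ 5 := pow_pos h.pos 5
  have e10 : δ ^ 10 = δ ^ 5 * δ ^ 5 := by ring
  have e20 : δ ^ 20 = δ ^ 5 * δ ^ 5 * (δ ^ 5 * δ ^ 5) := by ring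
  rw [e10, e20]
  set t := δ ^ 5
  set m := δ ^ 4
  -- A nonzero coefficient is at least `δ ^ 4`, and everything of higher order is at most `100000 *
  -- δ ^ 5 < δ ^ 4`.
  have sp : ∀ a b : ℝ, m ≤ |a| → |b| ≤ 100000 → a + b * t ≠ 0 := by
    intro a b ha hb' h0
    have : |a| = |b| * t := by
      rw [eq_neg_of_add_eq_zero_left h0, abs_neg, abs_mul, abs_of_pos h5p]
    nlinarith [abs_nonneg b]
  have b1 := abs_le.1 (hb 1)
  have b2 := abs_le.1 (hb 2)
  have b3 := abs_le.1 (hb 3)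
  have ht2 : t * t ≤ 1 := by nlinarith
  have ht2p : 0 < t * t := by positivity
  have c3 : |g 3 * (t * t)| ≤ 200 := by
    rw [abs_mul, abs_of_pos ht2p]; nlinarith [hb 3, abs_nonneg (g 3)]
  have c3' : |g 3 * t| ≤ 200 := by
    rw [abs_mul, abs_of_pos h5p]; nlinarith [hb 3, abs_nonneg (g 3)]
  have c2 : |g 2 + g 3 * (t * t)| ≤ 400 := (abs_add_le _ _).trans (by linarith [hb 2])
  have c2' : |(g 2 + g 3 * (t * t)) * t| ≤ 400 := by
    rw [abs_mul, abs_of_pos h5p]; nlinarith [abs_nonneg (g 2 + g 3 * (t * t))]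
  have c1 : |g 1 + (g 2 + g 3 * (t * t)) * t| ≤ 600 :=
    (abs_add_le _ _).trans (by linarith [hb 1])
  by_cases h0 : g 0 = 0
  · by_cases h1 : g 1 = 0
    · by_cases h2 : g 2 = 0
      · have h3 : g 3 ≠ 0 := by
          obtain ⟨i, hi⟩ := hne
          fin_cases i <;> simp_all
        rw [h0, h1, h2]
        simpa using ⟨h3, h5p.ne'⟩
      · have := sp (g 2) (g 3 * t) (key 2 h2) (by linarith)
        rw [h0, h1]
        intro h
        apply this
        have : (t * t) * (g 2 + g 3 * t * t) = 0 := by linear_combination h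
        exact (mul_eq_zero.1 this).resolve_left ht2p.ne'
    · have := sp (g 1) (g 2 + g 3 * (t * t)) (key 1 h1) (by linarith)
      rw [h0]
      intro h
      apply this
      have : t * (g 1 + (g 2 + g 3 * (t * t)) * t) = 0 := by linear_combination h
      exact (mul_eq_zero.1 this).resolve_left h5p.ne'
  · have := sp (g 0) _ (key 0 h0) (c1.trans (by norm_num))
    intro h
    apply this
    linear_combination h

variable {a b c r : ℝ × ℝ}

lemma GridPoint.onGrid_orient (ha : GridPoint δ a) (hb : GridPoint δ b)
    (hcx : OnGrid δ c.1) (hcy : OnGrid δ c.2) : OnGrid (δ * δ) (orient a b c) :=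
  ((hb.fst.sub ha.fst).mul (hcy.sub ha.snd)).sub ((hb.snd.sub ha.snd).mul (hcx.sub ha.fst))

lemma abs_mul_sub_mul_le {x y z w A B : ℝ} (hx : |x| ≤ A) (hy : |y| ≤ B) (hz : |z| ≤ A)
    (hw : |w| ≤ B) : |x * y - z * w| ≤ 2 * (A * B) := by
  have h1 : |x * y| ≤ A * B := by
    rw [abs_mul]; exact mul_le_mul hx hy (abs_nonneg _) ((abs_nonneg _).trans hx)
  have h2 : |z * w| ≤ A * B := by
    rw [abs_mul]; exact mul_le_mul hz hw (abs_nonneg _) ((abs_nonneg _).trans hz)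
  exact (abs_sub _ _).trans (by linarith)

lemma orient_ne_zero_of_near (h : UnitFrac δ) (ha : GridPoint δ a) (hb : GridPoint δ b)
    (hr : GridPoint δ r) (hab : a ≠ b) : orient a b (r.1 + δ ^ 5, r.2 + δ ^ 10) ≠ 0 := by
  have h0 := h.pos
  have ax := ha.fst_le
  have ay := ha.snd_le
  have bx := hb.fst_le
  have bY := hb.snd_le
  have rx := hr.fst_le
  have ry := hr.snd_le
  have d1 : |b.1 - a.1| ≤ 2 := (abs_sub _ _).trans (by linarith)
  have d2 : |b.2 - a.2| ≤ 2 := (abs_sub _ _).trans (by linarith)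
  have d3 : |r.1 - a.1| ≤ 2 := (abs_sub _ _).trans (by linarith)
  have d4 : |r.2 - a.2| ≤ 2 := (abs_sub _ _).trans (by linarith)
  -- The coefficients of `orient` as a polynomial in `δ ^ 5`. Those of the first and second power
  -- are the coordinates of `a - b` up to sign, and `a ≠ b`.
  have := sparse_poly_ne_zero h (g := ![orient a b r, a.2 - b.2, b.1 - a.1, 0]) ?_ ?_ ?_
  · intro h0
    apply this
    refine Eq.trans ?_ h0
    simp only [Matrix.cons_val]
    simp only [orient]
    ring
  · have e2 : OnGrid (δ ^ 2) (orient a b r) := by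
      rw [pow_two]; exact ha.onGrid_orient hb hr.fst hr.snd
    have one : ∀ {x : ℝ}, OnGrid δ x → OnGrid (δ ^ 4) x := fun hx =>
      OnGrid.finer (j := 1) (by simpa using hx) h (by norm_num)
    intro i
    fin_cases i
    · exact e2.finer h (by norm_num)
    · exact one (ha.snd.sub hb.snd)
    · exact one (hb.fst.sub ha.fst)
    · exact OnGrid.zero _
  · intro i
    fin_cases i
    · exact (abs_mul_sub_mul_le d1 d4 d2 d3).trans (by norm_num)
    · exact (abs_sub_comm _ _).trans_le (d2.trans (by norm_num))
    · exact d1.trans (by norm_num)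
    · norm_num
  · by_contra! hz
    exact hab (Prod.ext (by simpa [sub_eq_zero, eq_comm] using hz 2)
      (by simpa [sub_eq_zero] using hz 1))

/-- The determinant is quadratic in its last point with leading part `orient a b c` times the
squared norm. The second coordinate moves by the square of the first perturbation, so the fourth
power of `δ ^ 5` occurs only with coefficient `orient a b c ≠ 0`. -/
lemma incirc_ne_zero_of_near (h : UnitFrac δ) (ha : GridPoint δ a) (hb : GridPoint δ b)
    (hc : GridPoint δ c) (hr : GridPoint δ r) (habc : orient a b c ≠ 0) :
    incirc a b c (r.1 + δ ^ 5, r.2 + δ ^ 10) ≠ 0 := by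
  have h0 := h.pos
  have grid : ∀ {p : ℝ × ℝ}, GridPoint δ p → OnGrid (δ ^ 1) (p.1 - a.1) ∧
      OnGrid (δ ^ 1) (p.2 - a.2) ∧ |p.1 - a.1| ≤ 2 ∧ |p.2 - a.2| ≤ 2 := by
    intro p hp
    rw [pow_one]
    refine ⟨hp.fst.sub ha.fst, hp.snd.sub ha.snd, (abs_sub _ _).trans ?_, (abs_sub _ _).trans ?_⟩
    · linarith [hp.fst_le, ha.fst_le]
    · linarith [hp.snd_le, ha.snd_le]
  obtain ⟨gb1, gb2, db1, db2⟩ := grid hb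
  obtain ⟨gc1, gc2, dc1, dc2⟩ := grid hc
  obtain ⟨gr1, gr2, dr1, dr2⟩ := grid hr
  have mulG : ∀ {x y : ℝ} {j k : ℕ}, OnGrid (δ ^ j) x → OnGrid (δ ^ k) y →
      OnGrid (δ ^ (j + k)) (x * y) := fun hx hy => by rw [pow_add]; exact hx.mul hy
  have sq : ∀ {x y : ℝ}, OnGrid (δ ^ 1) x → OnGrid (δ ^ 1) y → |x| ≤ 2 → |y| ≤ 2 →
      OnGrid (δ ^ 2) (x ^ 2 + y ^ 2) ∧ |x ^ 2 + y ^ 2| ≤ 8 := by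
    intro x y hx hy bx bY
    constructor
    · rw [pow_two x, pow_two y]; exact (mulG hx hx).add (mulG hy hy)
    · rw [abs_of_nonneg (by positivity)]
      have := sq_le_sq' (abs_le.1 bx).1 (abs_le.1 bx).2
      have := sq_le_sq' (abs_le.1 bY).1 (abs_le.1 bY).2
      linarith
  have cross : ∀ {x y z w : ℝ} {j k : ℕ}, OnGrid (δ ^ j) x → OnGrid (δ ^ k) y →
      OnGrid (δ ^ j) z → OnGrid (δ ^ k) w → OnGrid (δ ^ (j + k)) (x * y - z * w) :=
    fun hx hy hz hw => (mulG hx hy).sub (mulG hz hw)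
  obtain ⟨sb, sb'⟩ := sq gb1 gb2 db1 db2
  obtain ⟨sc, sc'⟩ := sq gc1 gc2 dc1 dc2
  obtain ⟨sr, sr'⟩ := sq gr1 gr2 dr1 dr2
  have oc : OnGrid (δ ^ 2) (orient a b c) := cross gb1 gc2 gb2 gc1
  have oc' : |orient a b c| ≤ 8 := (abs_mul_sub_mul_le db1 dc2 db2 dc1).trans (by norm_num)
  have obr : OnGrid (δ ^ 2) (orient a b r) := cross gb1 gr2 gb2 gr1
  have obr' : |orient a b r| ≤ 8 := (abs_mul_sub_mul_le db1 dr2 db2 dr1).trans (by norm_num)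
  have ocr : OnGrid (δ ^ 2) (orient a c r) := cross gc1 gr2 gc2 gr1
  have ocr' : |orient a c r| ≤ 8 := (abs_mul_sub_mul_le dc1 dr2 dc2 dr1).trans (by norm_num)
  have E1 : OnGrid (δ ^ 3) (((c.1 - a.1) ^ 2 + (c.2 - a.2) ^ 2) * (b.2 - a.2)
      - ((b.1 - a.1) ^ 2 + (b.2 - a.2) ^ 2) * (c.2 - a.2)) := cross sc gb2 sb gc2
  have E1' := abs_mul_sub_mul_le sc' db2 sb' dc2
  have E2 : OnGrid (δ ^ 3) (((b.1 - a.1) ^ 2 + (b.2 - a.2) ^ 2) * (c.1 - a.1)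
      - ((c.1 - a.1) ^ 2 + (c.2 - a.2) ^ 2) * (b.1 - a.1)) := cross sb gc1 sc gb1
  have E2' := abs_mul_sub_mul_le sb' dc1 sc' db1
  have T1 : OnGrid (δ ^ 3) (orient a b c * (r.1 - a.1)) := mulG oc gr1
  have T2 : OnGrid (δ ^ 3) (orient a b c * (r.2 - a.2)) := mulG oc gr2
  have bm : ∀ {x y A B : ℝ}, |x| ≤ A → |y| ≤ B → |x * y| ≤ A * B := fun hx hy => by
    rw [abs_mul]; exact mul_le_mul hx hy (abs_nonneg _) ((abs_nonneg _).trans hx)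
  have T1' := bm oc' dr1
  have T2' := bm oc' dr2
  have := sparse_poly_ne_zero h (g := ![incirc a b c r,
    2 * (orient a b c * (r.1 - a.1)) + (((c.1 - a.1) ^ 2 + (c.2 - a.2) ^ 2) * (b.2 - a.2)
      - ((b.1 - a.1) ^ 2 + (b.2 - a.2) ^ 2) * (c.2 - a.2)),
    orient a b c + (2 * (orient a b c * (r.2 - a.2)) +
      (((b.1 - a.1) ^ 2 + (b.2 - a.2) ^ 2) * (c.1 - a.1)
      - ((c.1 - a.1) ^ 2 + (c.2 - a.2) ^ 2) * (b.1 - a.1))), orient a b c]) ?_ ?_ ?_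
  · intro h0
    apply this
    refine Eq.trans ?_ h0
    simp only [Matrix.cons_val]
    simp only [incirc, orient]
    ring
  · intro i
    fin_cases i
    · exact ((mulG oc sr).sub (mulG sc obr)).add (mulG sb ocr)
    · exact ((T1.zsmul 2).add E1).finer h (by norm_num)
    · exact (oc.finer h (by norm_num)).add (((T2.zsmul 2).add E2).finer h (by norm_num))
    · exact oc.finer h (by norm_num)
  · intro i
    fin_cases i
    · have i1 := abs_le.1 (bm oc' sr')
      have i2 := abs_le.1 (bm sc' obr')
      have i3 := abs_le.1 (bm sb' ocr')
      simp only [Fin.zero_eta, Matrix.cons_val, incirc]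
      exact abs_le.2 ⟨by linarith, by linarith⟩
    · have i1 := abs_le.1 T1'
      have i2 := abs_le.1 E1'
      simp only [Fin.mk_one, Matrix.cons_val]
      exact abs_le.2 ⟨by linarith, by linarith⟩
    · have i1 := abs_le.1 T2'
      have i2 := abs_le.1 E2'
      have i3 := abs_le.1 oc'
      simp only [Fin.reduceFinMk, Matrix.cons_val]
      exact abs_le.2 ⟨by linarith, by linarith⟩
    · exact oc'.trans (by norm_num)
  · exact ⟨3, habc⟩

/-- A set in general position on a grid stays in general position when a generic point is added. -/
lemma GenPos.insert_near {S : Set (ℝ × ℝ)} (hS : GenPos S) (h : UnitFrac δ)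
    (hg : ∀ a ∈ S, GridPoint δ a) (hr : GridPoint δ r) :
    GenPos (insert (r.1 + δ ^ 5, r.2 + δ ^ 10) S) := by
  set q : ℝ × ℝ := (r.1 + δ ^ 5, r.2 + δ ^ 10) with hq
  have line : ∀ a ∈ S, ∀ b ∈ S, a ≠ b → orient a b q ≠ 0 := fun a ha b hb hab =>
    orient_ne_zero_of_near h (hg a ha) (hg b hb) hr hab
  have circle : ∀ a ∈ S, ∀ b ∈ S, ∀ c ∈ S, a ≠ b → a ≠ c → b ≠ c → incirc a b c q ≠ 0 :=
    fun a ha b hb c hc hab hac hbc => incirc_ne_zero_of_near h (hg a ha) (hg b hb) (hg c hc) hr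
      (hS.line a ha b hb c hc hab hac hbc)
  clear_value q
  constructor
  · rintro a (rfl | ha) b (rfl | hb) c (rfl | hc) hab hac hbc
    · exact absurd rfl hab
    · exact absurd rfl hab
    · exact absurd rfl hac
    · have := line b hb c hc hbc
      contrapose! this; rw [← this]; simp only [orient]; ring
    · exact absurd rfl hbc
    · have := line a ha c hc hac
      contrapose! this; rw [← neg_eq_zero, ← this]; simp only [orient]; ring
    · exact line a ha b hb hab
    · exact hS.line a ha b hb c hc hab hac hbc
  -- Only the cases with the new point in at most one place survive; permuting the arguments changes
  -- the determinant at most by a sign, which brings that point to the last place.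
  · rintro a (rfl | ha) b (rfl | hb) c (rfl | hc) d (rfl | hd) hab hac had hbc hbd hcd
    all_goals first
      | exact absurd rfl hab
      | exact absurd rfl hac
      | exact absurd rfl had
      | exact absurd rfl hbc
      | exact absurd rfl hbd
      | exact absurd rfl hcd
      | skip
    · have := circle b hb c hc d hd hbc hbd hcd
      contrapose! this; rw [← neg_eq_zero, ← this]; simp only [incirc, orient]; ring
    · have := circle a ha c hc d hd hac had hcd
      contrapose! this; rw [← this]; simp only [incirc, orient]; ring
    · have := circle a ha b hb d hd hab had hbd
      contrapose! this; rw [← neg_eq_zero, ← this]; simp only [incirc, orient]; ring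
    · exact circle a ha b hb c hc hab hac hbc
    · exact hS.circle a ha b hb c hc d hd hab hac had hbc hbd hcd

lemma GridPoint.near (h : UnitFrac δ) (hr : GridPoint δ r) :
    GridPoint (δ ^ 10) (r.1 + δ ^ 5, r.2 + δ ^ 10) := by
  have h5 : 1000000 * δ ^ 5 ≤ δ ^ 4 := h.pow_lt_pow 4
  have h4 : δ ^ 4 ≤ δ := by simpa using h.pow_le (show 1 ≤ 4 by norm_num)
  have h10 := h.pow_le (show 5 ≤ 10 by norm_num)
  have p5 := pow_pos h.pos 5
  have p10 := pow_pos h.pos 10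
  have gr : OnGrid (δ ^ 10) δ := by simpa using OnGrid.pow_pow h (show 1 ≤ 10 by norm_num)
  refine ⟨(hr.fst.trans gr).add (OnGrid.pow_pow h (by norm_num)),
    (hr.snd.trans gr).add (OnGrid.self _), ?_, ?_⟩
  · have := abs_add_le r.1 (δ ^ 5)
    rw [abs_of_pos p5] at this
    dsimp only
    linarith [hr.fst_le]
  · have := abs_add_le r.2 (δ ^ 10)
    rw [abs_of_pos p10] at this
    dsimp only
    linarith [hr.snd_le]

lemma GridPoint.finer (h : UnitFrac δ) (hr : GridPoint δ r) {k : ℕ} (hk : k ≠ 0) :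
    GridPoint (δ ^ k) r := by
  have gr : OnGrid (δ ^ k) δ := by
    simpa using OnGrid.pow_pow h (show 1 ≤ k from Nat.one_le_iff_ne_zero.2 hk)
  have : δ ^ k ≤ δ := by simpa using h.pow_le (show 1 ≤ k from Nat.one_le_iff_ne_zero.2 hk)
  exact ⟨hr.fst.trans gr, hr.snd.trans gr, by linarith [hr.fst_le], by linarith [hr.snd_le]⟩

end Extend

/-! ### Attaching a leaf -/

/-- The squared distance. -/
def sqDist (a b : ℝ × ℝ) : ℝ := (a.1 - b.1) ^ 2 + (a.2 - b.2) ^ 2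

/-- The circle around `c` through `a` passes through `b`, its center is higher than both points, and
all other points of `S` are strictly outside. -/
structure HighEmptyDisk (S : Set (ℝ × ℝ)) (c a b : ℝ × ℝ) : Prop where
  eq : sqDist c a = sqDist c b
  left_lt : a.2 < c.2
  right_lt : b.2 < c.2
  empty : ∀ q ∈ S, q ≠ a → q ≠ b → sqDist c a < sqDist c q

lemma HighEmptyDisk.symm {S : Set (ℝ × ℝ)} {c a b : ℝ × ℝ} (h : HighEmptyDisk S c a b) :
    HighEmptyDisk S c b a :=
  ⟨h.eq.symm, h.right_lt, h.left_lt, fun q hq hb ha => h.eq ▸ h.empty q hq ha hb⟩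

/-- A realization of the part of the graph `G` induced by `A`, on the grid of width `δ`. -/
structure Realizes {V : Type*} (G : SimpleGraph V) (δ : ℝ) (A : Set V) (p : V → ℝ × ℝ)
    (W : Set (ℝ × ℝ)) : Prop where
  unit : UnitFrac δ
  grid : ∀ a ∈ p '' A ∪ W, GridPoint δ a
  genPos : GenPos (p '' A ∪ W)
  injOn : Set.InjOn p A
  edge : ∀ u ∈ A, ∀ v ∈ A, G.Adj u v →
    ∃ c, GridPoint δ c ∧ HighEmptyDisk (p '' A ∪ W) c (p u) (p v)
  nonedge : ∀ u ∈ A, ∀ v ∈ A, u ≠ v → ¬ G.Adj u v →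
    ∀ c, sqDist c (p u) = sqDist c (p v) → ∃ w ∈ W, sqDist c w < sqDist c (p u)

/-- The generic point near `r` on a finer grid. -/
noncomputable def nearPoint (δ : ℝ) (r : ℝ × ℝ) : ℝ × ℝ := (r.1 + δ ^ 5, r.2 + δ ^ 10)

/-- The location of a leaf attached to the vertex at `x`. -/
noncomputable def leafPoint (δ : ℝ) (x : ℝ × ℝ) : ℝ × ℝ := nearPoint (δ ^ 6) (x.1 + δ ^ 6, x.2 - δ ^ 4)

/-- The approximate location of a witness close to the leaf `y` attached to `x`. -/
noncomputable def witnessBase (δ : ℝ) (x y : ℝ × ℝ) (P K : ℤ) : ℝ × ℝ :=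
  (y.1 + 1 / 16 * (P * (y.1 - x.1) - K * (δ ^ 2 * (y.2 - x.2))),
    y.2 + 1 / 16 * (P * (y.2 - x.2) + K * (δ ^ 2 * (y.1 - x.1))))

/-- The witnesses accompanying the leaf attached to `x`. -/
noncomputable def leafWitness (δ : ℝ) (x : ℝ × ℝ) (i : Fin 3) : ℝ × ℝ :=
  nearPoint ((δ ^ 63) ^ 10 ^ (i : ℕ))
    (witnessBase δ x (leafPoint δ x) (![-8, 8, 0] i) (![-3, 5, -16] i))

/-- The width of the grid needed after attaching a leaf. -/
noncomputable def nextWidth (δ : ℝ) : ℝ := (δ ^ 63) ^ 10 ^ 3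

/-! ### Estimates around a new leaf. -/

section Local

lemma pow_succ_le_of_small {t : ℝ} (ht : 0 < t) (ht1 : 1000000 * t ≤ 1) (n : ℕ) :
    1000000 * t ^ (n + 1) ≤ t ^ n := by
  have := mul_le_mul_of_nonneg_left ht1 (pow_pos ht n).le
  rw [pow_succ]; linarith

lemma abs_mul_le_mul {x y A B : ℝ} (hx : |x| ≤ A) (hy : |y| ≤ B) : |x * y| ≤ A * B := by
  rw [abs_mul]; exact mul_le_mul hx hy (abs_nonneg _) ((abs_nonneg _).trans hx)

/-- The witnesses lie outside the disk around `(v₁ / 2 - σ₂, v₂ / 2 + σ₁)` through the origin and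
`v = t σ`. -/
lemma outside_leaf_disk {t σ₁ σ₂ e₁ e₂ p k : ℝ} (ht : 0 < t) (ht1 : 1000000 * t ≤ 1)
    (h1 : t ^ 2 ≤ σ₁) (h1' : σ₁ ≤ 2 * t ^ 2) (h2 : -t ≤ σ₂) (h2' : σ₂ ≤ -t / 2)
    (he1 : 0 ≤ e₁) (he1' : e₁ ≤ t ^ 4) (he2 : 0 ≤ e₂) (he2' : e₂ ≤ t ^ 4)
    (hp : |p| ≤ 1 / 2) (hk : |k| ≤ 1) (hpk : 1 / 8 ≤ (1 / 2 + p) ^ 2 - 1 / 4 - 2 * k) :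
    (t * σ₁ / 2 - σ₂) ^ 2 + (t * σ₂ / 2 + σ₁) ^ 2 <
      (t * σ₁ / 2 - σ₂ - (t * σ₁ + (p * (t * σ₁) - k * (t * (t * σ₂))) + e₁)) ^ 2 +
      (t * σ₂ / 2 + σ₁ - (t * σ₂ + (p * (t * σ₂) + k * (t * (t * σ₁))) + e₂)) ^ 2 := by
  set z₁ := (1 / 2 + p) * (t * σ₁) - (k * t ^ 2 - 1) * σ₂ with hz1
  set z₂ := (1 / 2 + p) * (t * σ₂) + (k * t ^ 2 - 1) * σ₁ with hz2
  obtain ⟨hp1, hp2⟩ := abs_le.1 hp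
  obtain ⟨hk1, hk2⟩ := abs_le.1 hk
  have ht2 : 1000000 * t ^ 2 ≤ t := by simpa using pow_succ_le_of_small ht ht1 1
  have a1 : |σ₁| ≤ t := abs_le.2 ⟨by linarith, by linarith⟩
  have a2 : |σ₂| ≤ t := abs_le.2 ⟨by linarith, by linarith⟩
  have b1 : |(1 / 2 + p) * t| ≤ 1 := by
    have := abs_mul_le_mul (abs_le.2 ⟨by linarith, by linarith⟩ : |1 / 2 + p| ≤ 1)
      (abs_of_pos ht).le
    linarith
  have b2 : |k * t ^ 2 - 1| ≤ 2 := by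
    have := abs_mul_le_mul hk (abs_of_pos (pow_pos ht 2)).le
    refine (abs_sub _ _).trans ?_
    rw [abs_one]
    linarith
  have c1 : |z₁| ≤ 3 * t := by
    have i1 : |(1 / 2 + p) * t * σ₁| ≤ 1 * t := by
      rw [abs_mul]; exact mul_le_mul b1 a1 (abs_nonneg _) zero_le_one
    have i2 : |(k * t ^ 2 - 1) * σ₂| ≤ 2 * t := by
      rw [abs_mul]; exact mul_le_mul b2 a2 (abs_nonneg _) zero_le_two
    rw [hz1, ← mul_assoc]
    exact (abs_sub _ _).trans (by linarith)
  have c2 : |z₂| ≤ 3 * t := by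
    have i1 : |(1 / 2 + p) * t * σ₂| ≤ 1 * t := by
      rw [abs_mul]; exact mul_le_mul b1 a2 (abs_nonneg _) zero_le_one
    have i2 : |(k * t ^ 2 - 1) * σ₁| ≤ 2 * t := by
      rw [abs_mul]; exact mul_le_mul b2 a1 (abs_nonneg _) zero_le_two
    rw [hz2, ← mul_assoc]
    exact (abs_add_le _ _).trans (by linarith)
  have m1 : -(3 * t * t ^ 4) ≤ e₁ * z₁ := by
    have := mul_le_mul c1 he1' he1 (by linarith)
    have h3 := neg_abs_le (z₁ * e₁)
    rw [abs_mul, abs_of_nonneg he1] at h3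
    linarith
  have m2 : -(3 * t * t ^ 4) ≤ e₂ * z₂ := by
    have := mul_le_mul c2 he2' he2 (by linarith)
    have h3 := neg_abs_le (z₂ * e₂)
    rw [abs_mul, abs_of_nonneg he2] at h3
    linarith
  have big : t ^ 4 / 4 ≤ (t ^ 2) * (σ₁ ^ 2 + σ₂ ^ 2) := by
    have h3 : t ^ 2 / 4 ≤ σ₁ ^ 2 + σ₂ ^ 2 := by nlinarith [sq_nonneg σ₁]
    have := mul_le_mul_of_nonneg_left h3 (sq_nonneg t)
    linarith
  have t5 : 1000000 * t ^ 5 ≤ t ^ 4 := pow_succ_le_of_small ht ht1 4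
  -- Without the perturbation `e` the excess is `‖v‖ ^ 2 * ((1 / 2 + p) ^ 2 - 1 / 4 - 2 * k + (k *
  -- t) ^ 2)` with `v = t σ`; since `‖v‖ ^ 2 ≥ t ^ 4 / 4`, it beats the error terms of order `t ^
  -- 5`.
  have id1 : (t * σ₁ / 2 - σ₂ - (t * σ₁ + (p * (t * σ₁) - k * (t * (t * σ₂))) + e₁)) ^ 2 +
      (t * σ₂ / 2 + σ₁ - (t * σ₂ + (p * (t * σ₂) + k * (t * (t * σ₁))) + e₂)) ^ 2
      - ((t * σ₁ / 2 - σ₂) ^ 2 + (t * σ₂ / 2 + σ₁) ^ 2) =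
      t ^ 2 * (σ₁ ^ 2 + σ₂ ^ 2) * ((1 / 2 + p) ^ 2 - 1 / 4 - 2 * k) +
        t ^ 2 * (σ₁ ^ 2 + σ₂ ^ 2) * (k * t) ^ 2 +
        2 * (e₁ * z₁) + 2 * (e₂ * z₂) + e₁ ^ 2 + e₂ ^ 2 := by
    rw [hz1, hz2]; ring
  have q1 : t ^ 4 / 4 * (1 / 8) ≤
      t ^ 2 * (σ₁ ^ 2 + σ₂ ^ 2) * ((1 / 2 + p) ^ 2 - 1 / 4 - 2 * k) :=
    mul_le_mul big hpk (by norm_num) (by positivity)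
  have q2 : 0 ≤ t ^ 2 * (σ₁ ^ 2 + σ₂ ^ 2) * (k * t) ^ 2 := by positivity
  have : 0 < t ^ 4 := by positivity
  have w1 := sq_nonneg e₁
  have w2 := sq_nonneg e₂
  rw [show 3 * t * t ^ 4 = 3 * t ^ 5 by ring] at m1 m2
  clear_value z₁ z₂
  linarith

/-- For a witness `f` relative to the leaf, `‖C‖ ≤ ‖C - f‖` says `2 ⟪C, f⟫ ≤ ‖f‖ ^ 2`, and `‖f‖ ^ 2
≤ 8 * t ^ 4`. Up to the perturbation this is a linear inequality for the components of `C` along `v`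
and along its quarter turn. -/
lemma abs_le_of_outside {t v₁ v₂ C₁ C₂ e₁ e₂ p k : ℝ} (ht : 0 < t) (ht1 : 1000000 * t ≤ 1)
    (h1 : t ^ 3 ≤ v₁) (h1' : v₁ ≤ 2 * t ^ 3) (h2 : -t ^ 2 ≤ v₂) (h2' : v₂ ≤ -t ^ 2 / 2)
    (he1 : 0 ≤ e₁) (he1' : e₁ ≤ t ^ 4) (he2 : 0 ≤ e₂) (he2' : e₂ ≤ t ^ 4)
    (hp : |p| ≤ 1 / 2) (hk : |k| ≤ 1)
    (h : C₁ ^ 2 + C₂ ^ 2 ≤ (C₁ - (p * v₁ - k * (t * v₂) + e₁)) ^ 2 +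
      (C₂ - (p * v₂ + k * (t * v₁) + e₂)) ^ 2) :
    p * (C₁ * v₁ + C₂ * v₂) + k * (t * (C₂ * v₁ - C₁ * v₂)) ≤ t ^ 4 * (8 + (|C₁| + |C₂|)) := by
  have ht3 : 1000000 * t ^ 3 ≤ t ^ 2 := pow_succ_le_of_small ht ht1 2
  have ht4 : 1000000 * t ^ 4 ≤ t ^ 3 := pow_succ_le_of_small ht ht1 3
  have p3 := pow_pos ht 3
  have p4 := pow_pos ht 4
  have a1 : |v₁| ≤ 2 * t ^ 3 := abs_le.2 ⟨by linarith, h1'⟩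
  have a2 : |v₂| ≤ t ^ 2 := abs_le.2 ⟨by linarith, by linarith⟩
  have a1' : |t * v₁| ≤ 1 * (2 * t ^ 3) := abs_mul_le_mul (by rw [abs_of_pos ht]; linarith) a1
  have a2' : |t * v₂| ≤ 1 * t ^ 2 := abs_mul_le_mul (by rw [abs_of_pos ht]; linarith) a2
  obtain ⟨i1, i1'⟩ := abs_le.1 (abs_mul_le_mul hp a1)
  obtain ⟨i2, i2'⟩ := abs_le.1 (abs_mul_le_mul hp a2)
  obtain ⟨j1, j1'⟩ := abs_le.1 (abs_mul_le_mul hk a1')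
  obtain ⟨j2, j2'⟩ := abs_le.1 (abs_mul_le_mul hk a2')
  have f1 : |p * v₁ - k * (t * v₂) + e₁| ≤ 2 * t ^ 2 := abs_le.2 ⟨by linarith, by linarith⟩
  have f2 : |p * v₂ + k * (t * v₁) + e₂| ≤ 2 * t ^ 2 := abs_le.2 ⟨by linarith, by linarith⟩
  have g1 := sq_le_sq' (abs_le.1 f1).1 (abs_le.1 f1).2
  have g2 := sq_le_sq' (abs_le.1 f2).1 (abs_le.1 f2).2
  have k1 := neg_le_of_abs_le (abs_mul_le_mul (le_refl |C₁|) (by rwa [abs_of_nonneg he1] : |e₁| ≤ t ^ 4))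
  have k2 := neg_le_of_abs_le (abs_mul_le_mul (le_refl |C₂|) (by rwa [abs_of_nonneg he2] : |e₂| ≤ t ^ 4))
  set f₁ := p * v₁ - k * (t * v₂) + e₁ with hf1
  set f₂ := p * v₂ + k * (t * v₁) + e₂ with hf2
  have e : p * (C₁ * v₁ + C₂ * v₂) + k * (t * (C₂ * v₁ - C₁ * v₂)) =
      C₁ * f₁ + C₂ * f₂ - C₁ * e₁ - C₂ * e₂ := by rw [hf1, hf2]; ring
  linarith

/-- A disk whose center is far from the leaf contains one of its witnesses. -/
lemma center_near_of_outside {t v₁ v₂ C₁ C₂ : ℝ} {e₁ e₂ : Fin 3 → ℝ} (ht : 0 < t)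
    (ht1 : 1000000 * t ≤ 1)
    (h1 : t ^ 3 ≤ v₁) (h1' : v₁ ≤ 2 * t ^ 3) (h2 : -t ^ 2 ≤ v₂) (h2' : v₂ ≤ -t ^ 2 / 2)
    (he1 : ∀ i, 0 ≤ e₁ i) (he1' : ∀ i, e₁ i ≤ t ^ 4) (he2 : ∀ i, 0 ≤ e₂ i)
    (he2' : ∀ i, e₂ i ≤ t ^ 4)
    (h : ∀ i, C₁ ^ 2 + C₂ ^ 2 ≤
      (C₁ - (![-1 / 2, 1 / 2, 0] i * v₁ - ![-3 / 16, 5 / 16, -1] i * (t * v₂) + e₁ i)) ^ 2 +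
      (C₂ - (![-1 / 2, 1 / 2, 0] i * v₂ + ![-3 / 16, 5 / 16, -1] i * (t * v₁) + e₂ i)) ^ 2) :
    |C₁| ≤ 1000 * t ∧ |C₂| ≤ 1000 * t := by
  have key := fun i => abs_le_of_outside ht ht1 h1 h1' h2 h2' (he1 i) (he1' i) (he2 i) (he2' i)
    (p := ![-1 / 2, 1 / 2, 0] i) (k := ![-3 / 16, 5 / 16, -1] i)
    (by fin_cases i <;> norm_num) (by fin_cases i <;> norm_num [abs_le]) (h i)
  have k0 := key 0
  have k1 := key 1
  have k2 := key 2
  simp only [Matrix.cons_val] at k0 k1 k2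
  set K := |C₁| + |C₂| with hK
  set A := C₁ * v₁ + C₂ * v₂ with hA
  set B := C₂ * v₁ - C₁ * v₂ with hB
  set E := t ^ 4 * (8 + K) with hE
  have hK0 : 0 ≤ K := by positivity
  have hE0 : 0 < E := by positivity
  have ht2 : 1000000 * t ^ 2 ≤ t := by simpa using pow_succ_le_of_small ht ht1 1
  have ht3 : 1000000 * t ^ 3 ≤ t ^ 2 := pow_succ_le_of_small ht ht1 2
  have ht4 : 1000000 * t ^ 4 ≤ t ^ 3 := pow_succ_le_of_small ht ht1 3
  have p2 := pow_pos ht 2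
  have p3 := pow_pos ht 3
  -- The three half-planes in the `(A, t * B)`-plane have a bounded intersection: the sum of the
  -- first two inequalities bounds `t * B` above, the third bounds it below, and then the first two
  -- bound `A` on both sides.
  have bB : |t * B| ≤ 16 * E := abs_le.2 ⟨by linarith, by linarith⟩
  have bA : |A| ≤ 12 * E := abs_le.2 ⟨by linarith, by linarith⟩
  have a1 : |v₁| ≤ 2 * t ^ 3 := abs_le.2 ⟨by linarith, h1'⟩
  have a2 : |v₂| ≤ t ^ 2 := abs_le.2 ⟨by linarith, by linarith⟩
  have at1 : |t * v₁| ≤ t * (2 * t ^ 3) := abs_mul_le_mul (abs_of_pos ht).le a1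
  have at2 : |t * v₂| ≤ t * t ^ 2 := abs_mul_le_mul (abs_of_pos ht).le a2
  have big : t ^ 4 / 4 ≤ v₁ ^ 2 + v₂ ^ 2 := by nlinarith [sq_nonneg v₁]
  -- `C` is recovered from its components `A` and `B` in the orthogonal frame given by `v` and its
  -- quarter turn.
  have n1 : t * ((v₁ ^ 2 + v₂ ^ 2) * |C₁|) ≤ 12 * E * (t * (2 * t ^ 3)) + 16 * E * t ^ 2 := by
    have e : t * ((v₁ ^ 2 + v₂ ^ 2) * |C₁|) = |A * (t * v₁) - t * B * v₂| := by
      rw [show A * (t * v₁) - t * B * v₂ = t * ((v₁ ^ 2 + v₂ ^ 2) * C₁) by rw [hA, hB]; ring,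
        abs_mul, abs_mul, abs_of_pos ht,
        abs_of_nonneg (by positivity : 0 ≤ v₁ ^ 2 + v₂ ^ 2)]
    rw [e]
    exact (abs_sub _ _).trans (add_le_add (abs_mul_le_mul bA at1) (abs_mul_le_mul bB a2))
  have n2 : t * ((v₁ ^ 2 + v₂ ^ 2) * |C₂|) ≤
      12 * E * (t * t ^ 2) + 16 * E * (2 * t ^ 3) := by
    have e : t * ((v₁ ^ 2 + v₂ ^ 2) * |C₂|) = |A * (t * v₂) + t * B * v₁| := by
      rw [show A * (t * v₂) + t * B * v₁ = t * ((v₁ ^ 2 + v₂ ^ 2) * C₂) by rw [hA, hB]; ring,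
        abs_mul, abs_mul, abs_of_pos ht,
        abs_of_nonneg (by positivity : 0 ≤ v₁ ^ 2 + v₂ ^ 2)]
    rw [e]
    exact (abs_add_le _ _).trans (add_le_add (abs_mul_le_mul bA at2) (abs_mul_le_mul bB a1))
  have l1 : t * (t ^ 4 / 4 * |C₁|) ≤ t * ((v₁ ^ 2 + v₂ ^ 2) * |C₁|) := by gcongr
  have l2 : t * (t ^ 4 / 4 * |C₂|) ≤ t * ((v₁ ^ 2 + v₂ ^ 2) * |C₂|) := by gcongr
  have g4 : t ^ 4 ≤ t ^ 2 / 24 := by linarith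
  have r1 : t ^ 5 * |C₁| ≤ t ^ 5 * (68 * t * (8 + K)) := by
    have i1 := mul_le_mul_of_nonneg_left g4 hE0.le
    have i2 : E * t ^ 2 = t ^ 5 * (t * (8 + K)) := by rw [hE]; ring
    clear_value E
    linarith
  have r2 : t ^ 5 * |C₂| ≤ t ^ 5 * (t * (8 + K)) := by
    have i1 := mul_le_mul_of_nonneg_left ht3 hE0.le
    have i2 : E * t ^ 2 = t ^ 5 * (t * (8 + K)) := by rw [hE]; ring
    clear_value E
    have i3 : 0 < E * t ^ 2 := by positivity
    linarith
  have p5 := pow_pos ht 5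
  have s1 := le_of_mul_le_mul_left r1 p5
  have s2 := le_of_mul_le_mul_left r2 p5
  have s3 := mul_le_mul_of_nonneg_right ht1 hK0
  -- The bound `E` contains `K` itself; adding `s1` and `s2` gives `K ≤ 69 * t * (8 + K)`, and the
  -- term with `K` on the right is absorbed because `t` is small.
  have : K ≤ 1000 * t := by linarith
  constructor <;> linarith [abs_nonneg C₁, abs_nonneg C₂]

/-- `q` lies in a small box below `x`. -/
structure JustBelow (t : ℝ) (x q : ℝ × ℝ) : Prop where
  fst : |q.1 - x.1| ≤ 5 * t ^ 3
  lower : -(4 * t ^ 2) ≤ q.2 - x.2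
  upper : q.2 - x.2 ≤ -t ^ 2 / 8

variable {δ t : ℝ} {x q c z : ℝ × ℝ}

/-- Going down from `x`, away from a centre at height at least `δ`, gains at least `δ * t ^ 2 / 4 ≥
250 * t ^ 3` in squared distance, whereas the sideways displacement loses at most `20 * t ^ 3`. -/
lemma JustBelow.sqDist_lt (h : JustBelow t x q) (ht : 0 < t)
    (htδ : 1000 * t ≤ δ) (h1 : |c.1 - x.1| ≤ 2) (h2 : δ ≤ c.2 - x.2) :
    sqDist c x < sqDist c q := by
  have a1 : |(c.1 - x.1) * (q.1 - x.1)| ≤ 2 * (5 * t ^ 3) := by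
    rw [abs_mul]; exact mul_le_mul h1 h.fst (abs_nonneg _) (by norm_num)
  have a2 : (c.2 - x.2) * (q.2 - x.2) ≤ δ * (-t ^ 2 / 8) := by
    have := h.upper
    nlinarith [sq_nonneg t]
  have a3 := (abs_le.1 a1).2
  have e : sqDist c q - sqDist c x = (q.1 - x.1) ^ 2 + (q.2 - x.2) ^ 2
      - 2 * ((c.1 - x.1) * (q.1 - x.1)) - 2 * ((c.2 - x.2) * (q.2 - x.2)) := by
    simp only [sqDist]; ring
  have := mul_le_mul_of_nonneg_right htδ (sq_nonneg t)
  have : 0 < t ^ 3 := by positivity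
  nlinarith [sq_nonneg (q.1 - x.1), sq_nonneg (q.2 - x.2)]

lemma JustBelow.sqDist_ge (h : JustBelow t x q) (ht1 : 1000000 * t ≤ 1)
    (h1 : |c.1 - x.1| ≤ 2) (h2 : |c.2 - x.2| ≤ 2) :
    sqDist c x - 40 * t ^ 2 ≤ sqDist c q := by
  have d2 : |q.2 - x.2| ≤ 4 * t ^ 2 := abs_le.2 ⟨h.lower, by linarith [h.upper, sq_nonneg t]⟩
  have a1 : |(c.1 - x.1) * (q.1 - x.1)| ≤ 2 * (5 * t ^ 3) := by
    rw [abs_mul]; exact mul_le_mul h1 h.fst (abs_nonneg _) (by norm_num)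
  have a2 : |(c.2 - x.2) * (q.2 - x.2)| ≤ 2 * (4 * t ^ 2) := by
    rw [abs_mul]; exact mul_le_mul h2 d2 (abs_nonneg _) (by norm_num)
  have e : sqDist c q - sqDist c x = (q.1 - x.1) ^ 2 + (q.2 - x.2) ^ 2
      - 2 * ((c.1 - x.1) * (q.1 - x.1)) - 2 * ((c.2 - x.2) * (q.2 - x.2)) := by
    simp only [sqDist]; ring
  have := (abs_le.1 a1).2
  have := (abs_le.1 a2).2
  have : 1000000 * t ^ 3 ≤ t ^ 2 := by nlinarith [sq_nonneg t]
  nlinarith [sq_nonneg (q.1 - x.1), sq_nonneg (q.2 - x.2)]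

/-- If `a` is much closer to `x` than `z` is, in every coordinate, then it is closer to `x` than to
`z`. -/
lemma sqDist_lt_of_far {a : ℝ × ℝ} {m : ℝ} (hz : m < |z.1 - x.1| ∨ m < |z.2 - x.2|)
    (h1 : 4 * |a.1 - x.1| ≤ m) (h2 : 4 * |a.2 - x.2| ≤ m) : sqDist a x < sqDist a z := by
  have e : sqDist a z - sqDist a x = (z.1 - x.1) ^ 2 + (z.2 - x.2) ^ 2
      - 2 * ((a.1 - x.1) * (z.1 - x.1)) - 2 * ((a.2 - x.2) * (z.2 - x.2)) := by
    simp only [sqDist]; ring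
  have f1 := (le_abs_self _).trans_eq (abs_mul (a.1 - x.1) (z.1 - x.1))
  have f2 := (le_abs_self _).trans_eq (abs_mul (a.2 - x.2) (z.2 - x.2))
  rw [← sq_abs (z.1 - x.1), ← sq_abs (z.2 - x.2)] at e
  have n1 := abs_nonneg (z.1 - x.1)
  have n2 := abs_nonneg (z.2 - x.2)
  have n3 := abs_nonneg (a.1 - x.1)
  have n4 := abs_nonneg (a.2 - x.2)
  set X := |z.1 - x.1|
  set Y := |z.2 - x.2|
  have g1 := mul_le_mul_of_nonneg_right h1 n1
  have g2 := mul_le_mul_of_nonneg_right h2 n2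
  rcases hz with hz | hz <;> nlinarith [sq_nonneg (X - Y), sq_nonneg (X - 2 * Y),
    sq_nonneg (Y - 2 * X)]

end Local

/-! ### The leaf, its witnesses and the centre of its disk: positions and grids. -/

section Frame

variable {δ : ℝ} {x : ℝ × ℝ}

lemma leafPoint_fst_sub (δ : ℝ) (x : ℝ × ℝ) : (leafPoint δ x).1 - x.1 = δ ^ 6 + δ ^ 30 := by
  simp only [leafPoint, nearPoint]; ring

lemma leafPoint_snd_sub (δ : ℝ) (x : ℝ × ℝ) : (leafPoint δ x).2 - x.2 = -δ ^ 4 + δ ^ 60 := by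
  simp only [leafPoint, nearPoint]; ring

lemma UnitFrac.sq_small (h : UnitFrac δ) : 0 < δ ^ 2 ∧ 1000000 * δ ^ 2 ≤ δ ∧
    1000000 * δ ^ 2 ≤ 1 := by
  have h1 : 1000000 * δ ^ 2 ≤ δ := by simpa using h.pow_lt_pow 1
  exact ⟨pow_pos h.pos 2, h1, by linarith [h.le, h.pos]⟩

/-- The bounds on the vector from a vertex to the leaf attached to it. -/
lemma leafPoint_bounds (h : UnitFrac δ) (x : ℝ × ℝ) :
    (δ ^ 2) ^ 3 ≤ (leafPoint δ x).1 - x.1 ∧ (leafPoint δ x).1 - x.1 ≤ 2 * (δ ^ 2) ^ 3 ∧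
    -(δ ^ 2) ^ 2 ≤ (leafPoint δ x).2 - x.2 ∧ (leafPoint δ x).2 - x.2 ≤ -(δ ^ 2) ^ 2 / 2 := by
  rw [leafPoint_fst_sub, leafPoint_snd_sub, ← pow_mul, ← pow_mul]
  have h30 := h.pow_le (show 6 ≤ 30 by norm_num)
  have h60 := h.pow_le (show 5 ≤ 60 by norm_num)
  have h5 : 1000000 * δ ^ 5 ≤ δ ^ 4 := h.pow_lt_pow 4
  have p30 := pow_pos h.pos 30
  have p60 := pow_pos h.pos 60
  have p4 := pow_pos h.pos 4
  norm_num
  refine ⟨p30.le, ?_, p60.le, ?_⟩ <;> linarith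

lemma justBelow_of_bounds {t v₁ v₂ e₁ e₂ p k : ℝ} {q : ℝ × ℝ} (ht : 0 < t)
    (ht1 : 1000000 * t ≤ 1)
    (h1 : t ^ 3 ≤ v₁) (h1' : v₁ ≤ 2 * t ^ 3) (h2 : -t ^ 2 ≤ v₂) (h2' : v₂ ≤ -t ^ 2 / 2)
    (he1 : 0 ≤ e₁) (he1' : e₁ ≤ t ^ 4) (he2 : 0 ≤ e₂) (he2' : e₂ ≤ t ^ 4)
    (hp : |p| ≤ 1 / 2) (hk : |k| ≤ 1)
    (hq1 : q.1 - x.1 = v₁ + (p * v₁ - k * (t * v₂)) + e₁)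
    (hq2 : q.2 - x.2 = v₂ + (p * v₂ + k * (t * v₁)) + e₂) : JustBelow t x q := by
  have ht3 : 1000000 * t ^ 3 ≤ t ^ 2 := pow_succ_le_of_small ht ht1 2
  have ht4 : 1000000 * t ^ 4 ≤ t ^ 3 := pow_succ_le_of_small ht ht1 3
  have p3 := pow_pos ht 3
  have a1 : |v₁| ≤ 2 * t ^ 3 := abs_le.2 ⟨by linarith, h1'⟩
  have a2 : |v₂| ≤ t ^ 2 := abs_le.2 ⟨by linarith, by linarith⟩
  have b1 := abs_le.1 (abs_mul_le_mul hp a1)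
  have c1 := abs_le.1 (abs_mul_le_mul hk (abs_mul_le_mul (abs_of_pos ht).le a1))
  have c2 := abs_le.1 (abs_mul_le_mul hk (abs_mul_le_mul (abs_of_pos ht).le a2))
  have b2 := abs_le.1 (abs_mul_le_mul hp (by rw [abs_of_nonpos (by linarith)] : |v₂| ≤ -v₂))
  refine ⟨?_, ?_, ?_⟩
  · rw [hq1]
    exact abs_le.2 ⟨by linarith, by linarith⟩
  · rw [hq2]; linarith
  · rw [hq2]; linarith

lemma justBelow_leafPoint (h : UnitFrac δ) (x : ℝ × ℝ) :
    JustBelow (δ ^ 2) x (leafPoint δ x) := by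
  obtain ⟨h1, h2, h3, h4⟩ := leafPoint_bounds h x
  have p4 : 0 ≤ (δ ^ 2) ^ 4 := by positivity
  exact justBelow_of_bounds h.sq_small.1 h.sq_small.2.2 h1 h2 h3 h4 le_rfl p4 le_rfl p4
    (p := 0) (k := 0) (by norm_num) (by norm_num) (by ring) (by ring)

/-- The third bound is the condition for lying outside the disk of the new edge. For the three pairs
its right-hand side is `1 / 8`, `1 / 8` and `2`. -/
lemma leafWitness_coeff_bounds (i : Fin 3) :
    |(![-1 / 2, 1 / 2, 0] : Fin 3 → ℝ) i| ≤ 1 / 2 ∧ |(![-3 / 16, 5 / 16, -1] : Fin 3 → ℝ) i| ≤ 1 ∧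
    1 / 8 ≤ (1 / 2 + (![-1 / 2, 1 / 2, 0] : Fin 3 → ℝ) i) ^ 2 - 1 / 4
      - 2 * (![-3 / 16, 5 / 16, -1] : Fin 3 → ℝ) i := by
  fin_cases i <;> norm_num [abs_le]

lemma leafWitness_base_sub (δ : ℝ) (x : ℝ × ℝ) (i : Fin 3) :
    (witnessBase δ x (leafPoint δ x) (![-8, 8, 0] i) (![-3, 5, -16] i)).1 - (leafPoint δ x).1 =
      ![-1 / 2, 1 / 2, 0] i * ((leafPoint δ x).1 - x.1)
      - ![-3 / 16, 5 / 16, -1] i * (δ ^ 2 * ((leafPoint δ x).2 - x.2)) ∧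
    (witnessBase δ x (leafPoint δ x) (![-8, 8, 0] i) (![-3, 5, -16] i)).2 - (leafPoint δ x).2 =
      ![-1 / 2, 1 / 2, 0] i * ((leafPoint δ x).2 - x.2)
      + ![-3 / 16, 5 / 16, -1] i * (δ ^ 2 * ((leafPoint δ x).1 - x.1)) := by
  simp only [witnessBase]
  fin_cases i <;> constructor <;> simp <;> ring

lemma leafWitness_sub (δ : ℝ) (x : ℝ × ℝ) (i : Fin 3) :
    (leafWitness δ x i).1 - (leafPoint δ x).1 =
      ![-1 / 2, 1 / 2, 0] i * ((leafPoint δ x).1 - x.1)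
      - ![-3 / 16, 5 / 16, -1] i * (δ ^ 2 * ((leafPoint δ x).2 - x.2))
      + ((δ ^ 63) ^ 10 ^ (i : ℕ)) ^ 5 ∧
    (leafWitness δ x i).2 - (leafPoint δ x).2 =
      ![-1 / 2, 1 / 2, 0] i * ((leafPoint δ x).2 - x.2)
      + ![-3 / 16, 5 / 16, -1] i * (δ ^ 2 * ((leafPoint δ x).1 - x.1))
      + ((δ ^ 63) ^ 10 ^ (i : ℕ)) ^ 10 := by
  obtain ⟨h1, h2⟩ := leafWitness_base_sub δ x i
  simp only [leafWitness, nearPoint]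
  exact ⟨by linear_combination h1, by linear_combination h2⟩

lemma leafWitness_perturb (h : UnitFrac δ) (i j : ℕ) (hj : j ≠ 0) :
    0 ≤ ((δ ^ 63) ^ 10 ^ i) ^ j ∧ ((δ ^ 63) ^ 10 ^ i) ^ j ≤ (δ ^ 2) ^ 4 := by
  have h0 := h.pos
  refine ⟨by positivity, ?_⟩
  rw [← pow_mul, ← pow_mul, ← pow_mul]
  apply h.pow_le
  have : 0 < 10 ^ i * j := by positivity
  calc 2 * 4 ≤ 63 * 1 := by norm_num
    _ ≤ 63 * (10 ^ i * j) := Nat.mul_le_mul_left _ this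

lemma justBelow_leafWitness (h : UnitFrac δ) (x : ℝ × ℝ) (i : Fin 3) :
    JustBelow (δ ^ 2) x (leafWitness δ x i) := by
  obtain ⟨h1, h2, h3, h4⟩ := leafPoint_bounds h x
  obtain ⟨p1, p1'⟩ := leafWitness_perturb h i 5 (by norm_num)
  obtain ⟨p2, p2'⟩ := leafWitness_perturb h i 10 (by norm_num)
  obtain ⟨s1, s2⟩ := leafWitness_sub δ x i
  obtain ⟨b1, b2, -⟩ := leafWitness_coeff_bounds i
  exact justBelow_of_bounds h.sq_small.1 h.sq_small.2.2 h1 h2 h3 h4 p1 p1' p2 p2' b1 b2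
    (by linear_combination s1) (by linear_combination s2)

lemma justBelow_witnessBase (h : UnitFrac δ) (x : ℝ × ℝ) (i : Fin 3) :
    JustBelow (δ ^ 2) x (witnessBase δ x (leafPoint δ x) (![-8, 8, 0] i) (![-3, 5, -16] i)) := by
  obtain ⟨h1, h2, h3, h4⟩ := leafPoint_bounds h x
  have p4 : 0 ≤ (δ ^ 2) ^ 4 := by positivity
  obtain ⟨s1, s2⟩ := leafWitness_base_sub δ x i
  obtain ⟨b1, b2, -⟩ := leafWitness_coeff_bounds i
  exact justBelow_of_bounds h.sq_small.1 h.sq_small.2.2 h1 h2 h3 h4 le_rfl p4 le_rfl p4 b1 b2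
    (by linear_combination s1) (by linear_combination s2)

lemma abs_add_le_one_of_near {a b ε : ℝ} (ha : |a| + δ ≤ 1) (hb : |b - a| ≤ δ / 2)
    (hε : ε ≤ δ / 2) : |b| + ε ≤ 1 := by
  have := abs_add_le a (b - a)
  rw [add_sub_cancel] at this
  linarith

lemma gridPoint_of_near {q : ℝ × ℝ} {k : ℕ} (h : UnitFrac δ) (hx : GridPoint δ x) (hk : 2 ≤ k)
    (h1 : |q.1 - x.1| ≤ δ / 2) (h2 : |q.2 - x.2| ≤ δ / 2)
    (g1 : OnGrid (δ ^ k) q.1) (g2 : OnGrid (δ ^ k) q.2) : GridPoint (δ ^ k) q := by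
  have hε : δ ^ k ≤ δ / 2 := by
    have := h.pow_le hk
    have := h.sq_small.2.1
    linarith [h.sq_small.1]
  exact ⟨g1, g2, abs_add_le_one_of_near hx.fst_le h1 hε, abs_add_le_one_of_near hx.snd_le h2 hε⟩

lemma JustBelow.abs_le {q : ℝ × ℝ} (hq : JustBelow (δ ^ 2) x q) (h : UnitFrac δ) :
    |q.1 - x.1| ≤ δ / 1000 ∧ |q.2 - x.2| ≤ δ / 1000 := by
  obtain ⟨t0, t1, t2⟩ := h.sq_small
  have ht2 : 1000000 * (δ ^ 2) ^ 2 ≤ δ ^ 2 := by simpa using pow_succ_le_of_small t0 t2 1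
  have ht3 : 1000000 * (δ ^ 2) ^ 3 ≤ (δ ^ 2) ^ 2 := pow_succ_le_of_small t0 t2 2
  have := h.pos
  exact ⟨by linarith [hq.fst], _root_.abs_le.2 ⟨by linarith [hq.lower],
    by linarith [hq.upper, sq_nonneg (δ ^ 2)]⟩⟩

lemma gridPoint_leafPoint (h : UnitFrac δ) (hx : GridPoint δ x) :
    GridPoint (δ ^ 60) (leafPoint δ x) := by
  have hδ : ∀ {a : ℝ}, OnGrid δ a → OnGrid (δ ^ 60) a := fun ha =>
    OnGrid.finer (j := 1) (by simpa using ha) h (by norm_num)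
  obtain ⟨a1, a2⟩ := (justBelow_leafPoint h x).abs_le h
  refine gridPoint_of_near h hx (by norm_num) (a1.trans (by linarith [h.pos]))
    (a2.trans (by linarith [h.pos])) ?_ ?_
  · rw [show (leafPoint δ x).1 = x.1 + (δ ^ 6 + δ ^ 30) by linarith [leafPoint_fst_sub δ x]]
    exact (hδ hx.fst).add ((OnGrid.pow_pow h (by norm_num)).add (OnGrid.pow_pow h (by norm_num)))
  · rw [show (leafPoint δ x).2 = x.2 + (-δ ^ 4 + δ ^ 60) by linarith [leafPoint_snd_sub δ x]]
    exact (hδ hx.snd).add ((OnGrid.pow_pow h (by norm_num)).neg.add (OnGrid.self _))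

/-- The exponent is `60` for the leaf, `2` more for the factor `δ ^ 2`, and `1` more for the factor
`1 / 16`, an integral multiple of `δ` because `1 / δ` is divisible by `16`. -/
lemma gridPoint_witnessBase (h : UnitFrac δ) (hx : GridPoint δ x) (i : Fin 3) :
    GridPoint (δ ^ 63) (witnessBase δ x (leafPoint δ x) (![-8, 8, 0] i) (![-3, 5, -16] i)) := by
  obtain ⟨a1, a2⟩ := (justBelow_witnessBase h x i).abs_le h
  have gy := gridPoint_leafPoint h hx
  have gx := hx.finer h (show 60 ≠ 0 by norm_num)
  have v1 := gy.fst.sub gx.fst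
  have v2 := gy.snd.sub gx.snd
  have tw : ∀ {a : ℝ}, OnGrid (δ ^ 60) a → OnGrid (δ ^ 62) (δ ^ 2 * a) := fun ha => by
    rw [show δ ^ 62 = δ ^ 2 * δ ^ 60 by ring]; exact (OnGrid.self _).mul ha
  have sx : ∀ {a : ℝ}, OnGrid (δ ^ 62) a → OnGrid (δ ^ 63) (1 / 16 * a) := fun ha => by
    rw [show δ ^ 63 = δ * δ ^ 62 by ring]; exact (OnGrid.div_sixteen h).mul ha
  refine gridPoint_of_near h hx (by norm_num) (a1.trans (by linarith [h.pos]))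
    (a2.trans (by linarith [h.pos])) ?_ ?_
  · exact (gy.fst.finer h (by norm_num)).add
      (sx (((v1.finer h (by norm_num)).zsmul _).sub ((tw v2).zsmul _)))
  · exact (gy.snd.finer h (by norm_num)).add
      (sx (((v2.finer h (by norm_num)).zsmul _).add ((tw v1).zsmul _)))

/-- The center of an empty disk through a vertex and the leaf attached to it. -/
noncomputable def leafCenter (δ : ℝ) (x : ℝ × ℝ) : ℝ × ℝ :=
  (x.1 + (δ ^ 2 * (δ ^ 4 + δ ^ 28) / 2 - (-δ ^ 2 + δ ^ 58)),
    x.2 + (δ ^ 2 * (-δ ^ 2 + δ ^ 58) / 2 + (δ ^ 4 + δ ^ 28)))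

/-- The centre is higher than `x` thanks to the tilt of the leaf: halfway to the leaf the height
drops by about `δ ^ 4 / 2`, but the normal component, proportional to the horizontal offset, raises
it by about `δ ^ 4`. -/
lemma leafCenter_bounds (h : UnitFrac δ) :
    |(leafCenter δ x).1 - x.1| ≤ δ / 1000 ∧ 0 < (leafCenter δ x).2 - x.2 ∧
      (leafCenter δ x).2 - x.2 ≤ δ / 1000 := by
  have h0 := h.pos
  have h28 := h.pow_le (show 5 ≤ 28 by norm_num)
  have h30 := h.pow_le (show 5 ≤ 30 by norm_num)
  have h6 := h.pow_le (show 5 ≤ 6 by norm_num)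
  have h60 := h.pow_le (show 5 ≤ 60 by norm_num)
  have h58 := h.pow_le (show 5 ≤ 58 by norm_num)
  have e2 : 1000000 * δ ^ 2 ≤ δ := h.sq_small.2.1
  have e3 : 1000000 * δ ^ 3 ≤ δ ^ 2 := h.pow_lt_pow 2
  have e4 : 1000000 * δ ^ 4 ≤ δ ^ 3 := h.pow_lt_pow 3
  have e5 : 1000000 * δ ^ 5 ≤ δ ^ 4 := h.pow_lt_pow 4
  have p4 := pow_pos h0 4
  have p28 := pow_pos h0 28
  have p30 := pow_pos h0 30
  have p6 := pow_pos h0 6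
  have p60 := pow_pos h0 60
  have p58 := pow_pos h0 58
  simp only [leafCenter, add_sub_cancel_left]
  refine ⟨_root_.abs_le.2 ⟨?_, ?_⟩, ?_, ?_⟩ <;> ring_nf <;> linarith

lemma gridPoint_leafCenter (h : UnitFrac δ) (hx : GridPoint δ x) :
    GridPoint (δ ^ 63) (leafCenter δ x) := by
  obtain ⟨a1, a2, a3⟩ := leafCenter_bounds (x := x) h
  have h0 := h.pos
  have gp : ∀ {j : ℕ}, j ≤ 60 → OnGrid (δ ^ 60) (δ ^ j) := fun hj => OnGrid.pow_pow h hj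
  have half : ∀ {a : ℝ}, OnGrid (δ ^ 60) a → OnGrid (δ ^ 63) (δ ^ 2 * a / 2) := by
    intro a ha
    rw [show δ ^ 63 = δ * (δ ^ 2 * δ ^ 60) by ring, show δ ^ 2 * a / 2 = 1 / 16 *
      ((8 : ℤ) * (δ ^ 2 * a)) by push_cast; ring]
    exact (OnGrid.div_sixteen h).mul (((OnGrid.self _).mul ha).zsmul _)
  have s1 : OnGrid (δ ^ 60) (δ ^ 4 + δ ^ 28) := (gp (by norm_num)).add (gp (by norm_num))
  have s2 : OnGrid (δ ^ 60) (-δ ^ 2 + δ ^ 58) := (gp (by norm_num)).neg.add (gp (by norm_num))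
  have gx := hx.finer h (show 63 ≠ 0 by norm_num)
  refine gridPoint_of_near h hx (by norm_num) (a1.trans (by linarith))
    (_root_.abs_le.2 ⟨by linarith, a3.trans (by linarith)⟩) ?_ ?_
  · exact gx.fst.add ((half s1).sub (s2.finer h (by norm_num)))
  · exact gx.snd.add ((half s2).add (s1.finer h (by norm_num)))

lemma sqDist_leafCenter_leafPoint (δ : ℝ) (x : ℝ × ℝ) :
    sqDist (leafCenter δ x) x = sqDist (leafCenter δ x) (leafPoint δ x) := by
  simp only [leafCenter, leafPoint, nearPoint, sqDist]
  ring

lemma sqDist_leafCenter_leafWitness (h : UnitFrac δ) (x : ℝ × ℝ) (i : Fin 3) :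
    sqDist (leafCenter δ x) x < sqDist (leafCenter δ x) (leafWitness δ x i) := by
  obtain ⟨p1, p1'⟩ := leafWitness_perturb h i 5 (by norm_num)
  obtain ⟨p2, p2'⟩ := leafWitness_perturb h i 10 (by norm_num)
  obtain ⟨s1, s2⟩ := leafWitness_sub δ x i
  obtain ⟨b1, b2, b3⟩ := leafWitness_coeff_bounds i
  obtain ⟨h1, h2, h3, h4⟩ := leafPoint_bounds h x
  obtain ⟨t0, t1, t2⟩ := h.sq_small
  have v1 : (leafPoint δ x).1 - x.1 = δ ^ 2 * (δ ^ 4 + δ ^ 28) := by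
    rw [leafPoint_fst_sub]; ring
  have v2 : (leafPoint δ x).2 - x.2 = δ ^ 2 * (-δ ^ 2 + δ ^ 58) := by
    rw [leafPoint_snd_sub]; ring
  have key := outside_leaf_disk (σ₁ := δ ^ 4 + δ ^ 28) (σ₂ := -δ ^ 2 + δ ^ 58) t0 t2
    (le_of_mul_le_mul_left (by linarith) t0) (le_of_mul_le_mul_left (by linarith) t0)
    (le_of_mul_le_mul_left (by linarith) t0) (le_of_mul_le_mul_left (by linarith) t0)
    p1 p1' p2 p2' b1 b2 b3
  rw [v1, v2] at s1 s2
  simp only [sqDist]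
  have c1 : (leafCenter δ x).1 - x.1 = δ ^ 2 * (δ ^ 4 + δ ^ 28) / 2 - (-δ ^ 2 + δ ^ 58) := by
    simp only [leafCenter]; ring
  have c2 : (leafCenter δ x).2 - x.2 = δ ^ 2 * (-δ ^ 2 + δ ^ 58) / 2 + (δ ^ 4 + δ ^ 28) := by
    simp only [leafCenter]; ring
  rw [c1, c2]
  refine key.trans_eq ?_
  congr 2
  · linear_combination -c1 + s1 + v1
  · linear_combination -c2 + s2 + v2

end Frame

/-! ### One attachment preserves the invariant. -/

section Attach

variable {δ : ℝ} {x : ℝ × ℝ} {S : Set (ℝ × ℝ)}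

lemma nearPoint_insert {i : ℕ} {r : ℝ × ℝ} (h : UnitFrac δ) (hS : GenPos S)
    (hg : ∀ a ∈ S, GridPoint ((δ ^ 63) ^ 10 ^ i) a) (hr : GridPoint (δ ^ 63) r) :
    GenPos (insert (nearPoint ((δ ^ 63) ^ 10 ^ i) r) S) ∧
      ∀ a ∈ insert (nearPoint ((δ ^ 63) ^ 10 ^ i) r) S,
        GridPoint ((δ ^ 63) ^ 10 ^ (i + 1)) a := by
  have h63 : UnitFrac (δ ^ 63) := h.pow (by norm_num)
  have hi : UnitFrac ((δ ^ 63) ^ 10 ^ i) := h63.pow (by positivity)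
  have hr' : GridPoint ((δ ^ 63) ^ 10 ^ i) r := hr.finer h63 (by positivity)
  have e : (δ ^ 63) ^ 10 ^ (i + 1) = ((δ ^ 63) ^ 10 ^ i) ^ 10 := by
    rw [pow_succ 10 i, pow_mul]
  rw [e]
  refine ⟨hS.insert_near hi hg hr', ?_⟩
  rintro a (rfl | ha)
  · exact hr'.near hi
  · exact (hg a ha).finer hi (by norm_num)

/-- The points of a configuration after attaching a leaf at `x`. -/
def withLeaf (δ : ℝ) (x : ℝ × ℝ) (S : Set (ℝ × ℝ)) : Set (ℝ × ℝ) :=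
  insert (leafPoint δ x) S ∪ Set.range (leafWitness δ x)

/-- The leaf and the three witnesses are added one at a time. Each is a generic perturbation at the
width of a grid that already carries all earlier points, and each witness raises the current width
to the tenth power. -/
lemma genPos_withLeaf (h : UnitFrac δ) (hS : GenPos S) (hg : ∀ a ∈ S, GridPoint δ a)
    (hx : GridPoint δ x) :
    GenPos (withLeaf δ x S) ∧ ∀ a ∈ withLeaf δ x S, GridPoint (nextWidth δ) a := by
  have h6 : UnitFrac (δ ^ 6) := h.pow (by norm_num)
  have hδ : ∀ {a : ℝ}, OnGrid δ a → OnGrid (δ ^ 6) a := fun ha =>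
    OnGrid.finer (j := 1) (by simpa using ha) h (by norm_num)
  have e2 : 1000000 * δ ^ 2 ≤ δ := h.sq_small.2.1
  have e4 := h.pow_le (show 2 ≤ 4 by norm_num)
  have e6 := h.pow_le (show 2 ≤ 6 by norm_num)
  have h0 := h.pos
  have p2 := pow_pos h0 2
  have p4 := pow_pos h0 4
  have p6 := pow_pos h0 6
  have hbase : GridPoint (δ ^ 6) (x.1 + δ ^ 6, x.2 - δ ^ 4) := by
    refine gridPoint_of_near h hx (by norm_num) (abs_le.2 ⟨?_, ?_⟩) (abs_le.2 ⟨?_, ?_⟩)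
      ((hδ hx.fst).add (OnGrid.self _)) ((hδ hx.snd).sub (OnGrid.pow_pow h (by norm_num)))
    all_goals dsimp only; linarith
  have s0 : GenPos (insert (leafPoint δ x) S) :=
    hS.insert_near h6 (fun a ha => (hg a ha).finer h (by norm_num)) hbase
  have g0 : ∀ a ∈ insert (leafPoint δ x) S, GridPoint ((δ ^ 63) ^ 10 ^ 0) a := by
    rw [pow_zero, pow_one]
    rintro a (rfl | ha)
    · have := gridPoint_leafPoint h hx
      refine gridPoint_of_near h hx (by norm_num) ?_ ?_ (this.fst.finer h (by norm_num))
        (this.snd.finer h (by norm_num))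
      · exact ((justBelow_leafPoint h x).abs_le h).1.trans (by linarith)
      · exact ((justBelow_leafPoint h x).abs_le h).2.trans (by linarith)
    · exact (hg a ha).finer h (by norm_num)
  obtain ⟨s1, g1⟩ := nearPoint_insert h s0 g0 (gridPoint_witnessBase h hx 0)
  obtain ⟨s2, g2⟩ := nearPoint_insert h s1 g1 (gridPoint_witnessBase h hx 1)
  obtain ⟨s3, g3⟩ := nearPoint_insert h s2 g2 (gridPoint_witnessBase h hx 2)
  have e : withLeaf δ x S = insert (leafWitness δ x 2) (insert (leafWitness δ x 1)
      (insert (leafWitness δ x 0) (insert (leafPoint δ x) S))) := by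
    ext q
    simp only [withLeaf, Set.mem_union, Set.mem_insert_iff, Set.mem_range, Fin.exists_fin_succ,
      IsEmpty.exists_iff]
    simp only [Fin.succ_zero_eq_one, Fin.succ_one_eq_two, eq_comm (b := q)]
    tauto
  rw [e]
  exact ⟨s3, g3⟩

lemma mem_withLeaf_cases {q : ℝ × ℝ} (h : UnitFrac δ) (hq : q ∈ withLeaf δ x S) :
    q ∈ S ∨ JustBelow (δ ^ 2) x q := by
  rcases hq with (rfl | hq) | ⟨i, rfl⟩
  · exact Or.inr (justBelow_leafPoint h x)
  · exact Or.inl hq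
  · exact Or.inr (justBelow_leafWitness h x i)

lemma GridPoint.far {q : ℝ × ℝ} (hδ : 0 < δ) (hx : GridPoint δ x) (hq : GridPoint δ q)
    (hne : q ≠ x) : δ ≤ |q.1 - x.1| ∨ δ ≤ |q.2 - x.2| := by
  by_cases h1 : q.1 = x.1
  · right
    refine (hq.snd.sub hx.snd).le_abs hδ fun h2 => hne (Prod.ext h1 (sub_eq_zero.1 h2))
  · left
    exact (hq.fst.sub hx.fst).le_abs hδ (sub_ne_zero.2 h1)

lemma GridPoint.abs_sub_le {q : ℝ × ℝ} (hδ : 0 < δ) (hx : GridPoint δ x) (hq : GridPoint δ q) :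
    |q.1 - x.1| ≤ 2 ∧ |q.2 - x.2| ≤ 2 :=
  ⟨(abs_sub _ _).trans (by linarith [hx.fst_le, hq.fst_le]),
    (abs_sub _ _).trans (by linarith [hx.snd_le, hq.snd_le])⟩

lemma sqDist_onGrid {a b : ℝ × ℝ} (ha : GridPoint δ a) (hb : GridPoint δ b) :
    OnGrid (δ * δ) (sqDist a b) := by
  simp only [sqDist, pow_two]
  exact ((ha.fst.sub hb.fst).mul (ha.fst.sub hb.fst)).add
    ((ha.snd.sub hb.snd).mul (ha.snd.sub hb.snd))

/-- The empty disk of an old edge stays empty when a leaf is attached at one of its ends. -/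
lemma HighEmptyDisk.withLeaf_left {c b : ℝ × ℝ} (h : UnitFrac δ) (hx : GridPoint δ x)
    (hc : GridPoint δ c) (hD : HighEmptyDisk S c x b) :
    HighEmptyDisk (withLeaf δ x S) c x b := by
  refine ⟨hD.eq, hD.left_lt, hD.right_lt, fun q hq hqx hqb => ?_⟩
  rcases mem_withLeaf_cases h hq with hq | hq
  · exact hD.empty q hq hqx hqb
  · have h2 : δ ≤ |c.2 - x.2| :=
      (hc.snd.sub hx.snd).le_abs h.pos (sub_ne_zero.2 hD.left_lt.ne')
    rw [abs_of_pos (sub_pos.2 hD.left_lt)] at h2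
    exact hq.sqDist_lt h.sq_small.1 (by linarith [h.sq_small.1, h.sq_small.2.1])
      (hx.abs_sub_le h.pos hc).1 h2

/-- The empty disk of an old edge stays empty when a leaf is attached somewhere else. -/
lemma HighEmptyDisk.withLeaf_other {a b c : ℝ × ℝ} (h : UnitFrac δ) (hx : GridPoint δ x)
    (hc : GridPoint δ c) (ha : GridPoint δ a) (hxS : x ∈ S) (hxa : x ≠ a) (hxb : x ≠ b)
    (hD : HighEmptyDisk S c a b) :
    HighEmptyDisk (withLeaf δ x S) c a b := by
  refine ⟨hD.eq, hD.left_lt, hD.right_lt, fun q hq hqx hqb => ?_⟩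
  rcases mem_withLeaf_cases h hq with hq | hq
  · exact hD.empty q hq hqx hqb
  · obtain ⟨t0, t1, t2⟩ := h.sq_small
    have h0 := hD.empty x hxS hxa hxb
    have h1 : δ * δ ≤ |sqDist c x - sqDist c a| :=
      ((sqDist_onGrid hc hx).sub (sqDist_onGrid hc ha)).le_abs (mul_pos h.pos h.pos)
        (sub_ne_zero.2 h0.ne')
    rw [abs_of_pos (sub_pos.2 h0), ← pow_two] at h1
    have h2 := hq.sqDist_ge (c := c) t2 (hx.abs_sub_le h.pos hc).1 (hx.abs_sub_le h.pos hc).2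
    have := mul_le_mul_of_nonneg_left t2 t0.le
    nlinarith

/-- The empty disk of the new edge. -/
lemma highEmptyDisk_leafCenter (h : UnitFrac δ) (hg : ∀ a ∈ S, GridPoint δ a)
    (hx : GridPoint δ x) :
    HighEmptyDisk (withLeaf δ x S) (leafCenter δ x) x (leafPoint δ x) := by
  obtain ⟨c1, c2, c3⟩ := leafCenter_bounds (x := x) h
  have h0 := h.pos
  refine ⟨sqDist_leafCenter_leafPoint δ x, by linarith, ?_, ?_⟩
  · linarith [(justBelow_leafPoint h x).upper, sq_nonneg (δ ^ 2)]
  · rintro q ((rfl | hq) | ⟨i, rfl⟩) hqx hqy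
    · exact absurd rfl hqy
    -- The centre is within `δ / 1000` of `x` in both coordinates, while another grid point differs
    -- from `x` by at least `δ` in one of them.
    · refine sqDist_lt_of_far (m := δ / 2) ?_ (by linarith) ?_
      · rcases hx.far h0 (hg q hq) hqx with h3 | h3
        · left; linarith
        · right; linarith
      · rw [abs_of_pos c2]; linarith
    · exact sqDist_leafCenter_leafWitness h x i

/-- Every disk through the leaf and a point other than its neighbour contains a new witness. -/
lemma exists_leafWitness_mem {c z : ℝ × ℝ} (h : UnitFrac δ) (hx : GridPoint δ x)
    (hz : GridPoint δ z) (hzx : z ≠ x) (hc : sqDist c (leafPoint δ x) = sqDist c z) :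
    ∃ i, sqDist c (leafWitness δ x i) < sqDist c (leafPoint δ x) := by
  by_contra! hout
  obtain ⟨t0, t1, t2⟩ := h.sq_small
  obtain ⟨h1, h2, h3, h4⟩ := leafPoint_bounds h x
  have h0 := h.pos
  have key := center_near_of_outside (C₁ := c.1 - (leafPoint δ x).1)
    (C₂ := c.2 - (leafPoint δ x).2) (e₁ := fun i => ((δ ^ 63) ^ 10 ^ (i : ℕ)) ^ 5)
    (e₂ := fun i => ((δ ^ 63) ^ 10 ^ (i : ℕ)) ^ 10) t0 t2 h1 h2 h3 h4
    (fun i => (leafWitness_perturb h i 5 (by norm_num)).1)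
    (fun i => (leafWitness_perturb h i 5 (by norm_num)).2)
    (fun i => (leafWitness_perturb h i 10 (by norm_num)).1)
    (fun i => (leafWitness_perturb h i 10 (by norm_num)).2) ?_
  · obtain ⟨y1, y2⟩ := (justBelow_leafPoint h x).abs_le h
    -- The centre is within `1000 * δ ^ 2 ≤ δ / 1000` of the leaf in both coordinates, and `z`
    -- differs from the leaf by more than `δ / 2` in one, so they cannot be equidistant from the
    -- centre.
    refine (sqDist_lt_of_far (a := c) (x := leafPoint δ x) (z := z) (m := δ / 2) ?_ ?_ ?_).ne hc
    · rcases hx.far h0 hz hzx with h5 | h5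
      · left
        have := abs_sub_abs_le_abs_sub (z.1 - x.1) ((leafPoint δ x).1 - x.1)
        rw [sub_sub_sub_cancel_right] at this
        linarith
      · right
        have := abs_sub_abs_le_abs_sub (z.2 - x.2) ((leafPoint δ x).2 - x.2)
        rw [sub_sub_sub_cancel_right] at this
        linarith
    · linarith [key.1]
    · linarith [key.2]
  · intro i
    obtain ⟨s1, s2⟩ := leafWitness_sub δ x i
    have := hout i
    simp only [sqDist] at this
    refine this.trans_eq ?_
    congr 2
    · linear_combination -s1
    · linear_combination -s2

/-- Attaching a leaf. -/
theorem Realizes.attach {V : Type*} [DecidableEq V] {G : SimpleGraph V} {A : Set V} {p : V → ℝ × ℝ}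
    {W : Set (ℝ × ℝ)} (R : Realizes G δ A p W) {u v : V} (hu : u ∈ A) (hv : v ∉ A)
    (huv : G.Adj u v) (honly : ∀ w ∈ A, G.Adj w v → w = u) :
    Realizes G (nextWidth δ) (insert v A) (Function.update p v (leafPoint δ (p u)))
      (W ∪ Set.range (leafWitness δ (p u))) := by
  have h := R.unit
  have hpu : p u ∈ p '' A ∪ W := Or.inl ⟨u, hu, rfl⟩
  have hx := R.grid _ hpu
  have hupd : ∀ w ∈ A, Function.update p v (leafPoint δ (p u)) w = p w := fun w hw =>
    Function.update_of_ne (by rintro rfl; exact hv hw) _ _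
  have hself : Function.update p v (leafPoint δ (p u)) v = leafPoint δ (p u) :=
    Function.update_self ..
  have hset : Function.update p v (leafPoint δ (p u)) '' insert v A ∪
      (W ∪ Set.range (leafWitness δ (p u))) = withLeaf δ (p u) (p '' A ∪ W) := by
    rw [Set.image_insert_eq, hself, Set.image_congr hupd, withLeaf, Set.insert_union,
      Set.insert_union, Set.union_assoc]
  obtain ⟨gp, gg⟩ := genPos_withLeaf h R.genPos R.grid hx
  have h63 : UnitFrac (δ ^ 63) := h.pow (by norm_num)
  have grid_next : ∀ {q}, GridPoint δ q → GridPoint (nextWidth δ) q := fun hq =>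
    (hq.finer h (show 63 ≠ 0 by norm_num)).finer h63 (by norm_num)
  -- The leaf is strictly below `x` but much closer to it than the grid width, so it is no old
  -- point.
  have hlow : ∀ w ∈ A, p w ≠ leafPoint δ (p u) := by
    intro w hw he
    by_cases hwu : p w = p u
    · have := (justBelow_leafPoint h (p u)).upper
      rw [← he, hwu, sub_self] at this
      have := pow_pos h.sq_small.1 2
      linarith
    · obtain ⟨y1, y2⟩ := (justBelow_leafPoint h (p u)).abs_le h
      have h0 := h.pos
      rcases hx.far h0 (R.grid (p w) (Or.inl ⟨w, hw, rfl⟩)) hwu with h5 | h5 <;>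
        rw [he] at h5 <;> linarith
  refine ⟨h63.pow (by norm_num), ?_, ?_, ?_, ?_, ?_⟩
  · rwa [hset]
  · rwa [hset]
  · rintro a (rfl | ha) b (rfl | hb) hab
    · rfl
    · rw [hself, hupd b hb] at hab
      exact absurd hab.symm (hlow b hb)
    · rw [hself, hupd a ha] at hab
      exact absurd hab (hlow a ha)
    · rw [hupd a ha, hupd b hb] at hab
      exact R.injOn ha hb hab
  · rw [hset]
    have new := highEmptyDisk_leafCenter h R.grid hx
    have newG := (gridPoint_leafCenter h hx).finer h63 (show 10 ^ 3 ≠ 0 by norm_num)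
    rintro a (rfl | ha) b (rfl | hb) hab
    · exact absurd rfl hab.ne
    · obtain rfl := honly b hb hab.symm
      rw [hself, hupd b hb]
      exact ⟨_, newG, new.symm⟩
    · obtain rfl := honly a ha hab
      rw [hself, hupd a ha]
      exact ⟨_, newG, new⟩
    · rw [hupd a ha, hupd b hb]
      obtain ⟨c, hc, hD⟩ := R.edge a ha b hb hab
      refine ⟨c, grid_next hc, ?_⟩
      by_cases hau : a = u
      · subst hau
        exact hD.withLeaf_left h hx hc
      · by_cases hbu : b = u
        · subst hbu
          exact (hD.symm.withLeaf_left h hx hc).symm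
        · exact hD.withLeaf_other h hx hc (R.grid _ (Or.inl ⟨a, ha, rfl⟩)) hpu
            (fun e => hau (R.injOn ha hu e.symm)) (fun e => hbu (R.injOn hb hu e.symm))
  · rintro a (rfl | ha) b (rfl | hb) hne hab c hc
    · exact absurd rfl hne
    · rw [hself, hupd b hb] at hc
      rw [hself]
      have hbu : b ≠ u := fun e => hab (e ▸ huv.symm)
      obtain ⟨i, hi⟩ := exists_leafWitness_mem h hx (R.grid _ (Or.inl ⟨b, hb, rfl⟩))
        (fun e => hbu (R.injOn hb hu e)) hc
      exact ⟨_, Or.inr ⟨i, rfl⟩, hi⟩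
    · rw [hself, hupd a ha] at hc
      rw [hupd a ha, hc]
      have hau : a ≠ u := fun e => hab (e ▸ huv)
      obtain ⟨i, hi⟩ := exists_leafWitness_mem h hx (R.grid _ (Or.inl ⟨a, ha, rfl⟩))
        (fun e => hau (R.injOn ha hu e)) hc.symm
      exact ⟨_, Or.inr ⟨i, rfl⟩, hi⟩
    · rw [hupd a ha, hupd b hb] at hc
      rw [hupd a ha]
      obtain ⟨w, hw, hlt⟩ := R.nonedge a ha b hb hne hab c hc
      exact ⟨w, Or.inl hw, hlt⟩

/-- A single vertex at the origin. -/
lemma realizes_singleton {V : Type*} (G : SimpleGraph V) (h : UnitFrac δ) (r : V) :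
    Realizes G δ {r} (fun _ => (0, 0)) ∅ := by
  have hd : δ ≤ 1 := by linarith [h.le, h.pos]
  have hS : (fun _ : V => ((0, 0) : ℝ × ℝ)) '' {r} ∪ ∅ = {(0, 0)} := by simp
  refine ⟨h, ?_, ?_, by simp, ?_, ?_⟩
  · rw [hS]
    rintro a rfl
    exact ⟨OnGrid.zero _, OnGrid.zero _, by simpa using hd, by simpa using hd⟩
  · rw [hS]
    constructor
    · rintro a rfl b rfl c - hab
      exact absurd rfl hab
    · rintro a rfl b rfl c - d - hab
      exact absurd rfl hab
  · rintro a rfl b rfl hab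
    exact absurd rfl hab.ne
  · rintro a rfl b rfl hab
    exact absurd rfl hab

end Attach

/-! ### Reasoning about programs -/

namespace RealRAM

/-- Programs without loops and divisions. -/
def Program.LoopFree : Program → Prop
  | .skip => True
  | .setNat _ _ => True
  | .putNat _ _ _ => True
  | .setReal _ _ => True
  | .putReal _ _ _ => True
  | .setDiv _ _ _ => False
  | .seq p q => p.LoopFree ∧ q.LoopFree
  | .branch _ p q => p.LoopFree ∧ q.LoopFree
  | .loop _ _ => False

/-- An upper bound on the running time of a loop-free program. -/
def Program.time : Program → ℕ
  | .skip => 1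
  | .setNat _ e => e.cost + 1
  | .putNat _ i e => i.cost + e.cost + 1
  | .setReal _ e => e.cost + 1
  | .putReal _ i e => i.cost + e.cost + 1
  | .setDiv _ _ _ => 0
  | .seq p q => p.time + q.time
  | .branch b p q => b.cost + (p.time + q.time)
  | .loop _ _ => 0

open Classical in
/-- The effect of a loop-free program. -/
noncomputable def Program.run : Program → State → State
  | .skip, s => s
  | .setNat x e, s => { s with nvar := Function.update s.nvar x (e.eval s) }
  | .putNat a i e, s =>
      { s with
        narr := Function.update s.narr a (Function.update (s.narr a) (i.eval s) (e.eval s)) }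
  | .setReal x e, s => { s with rvar := Function.update s.rvar x (e.eval s) }
  | .putReal a i e, s =>
      { s with
        rarr := Function.update s.rarr a (Function.update (s.rarr a) (i.eval s) (e.eval s)) }
  | .setDiv _ _ _, s => s
  | .seq p q, s => q.run (p.run s)
  | .branch b p q, s => if b.Holds s then p.run s else q.run s
  | .loop _ _, s => s

lemma Program.LoopFree.runs {p : Program} (hp : p.LoopFree) (s : State) :
    ∃ t ≤ p.time, Runs p s t (p.run s) := by
  induction p generalizing s with
  | skip => exact ⟨_, le_rfl, .skip s⟩
  | setNat x e => exact ⟨_, le_rfl, .setNat s x e⟩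
  | putNat a i e => exact ⟨_, le_rfl, .putNat s a i e⟩
  | setReal x e => exact ⟨_, le_rfl, .setReal s x e⟩
  | putReal a i e => exact ⟨_, le_rfl, .putReal s a i e⟩
  | setDiv x e f => exact hp.elim
  | seq p q ihp ihq =>
    obtain ⟨t, ht, h⟩ := ihp hp.1 s
    obtain ⟨t', ht', h'⟩ := ihq hp.2 (p.run s)
    exact ⟨_, add_le_add ht ht', .seq h h'⟩
  | branch b p q ihp ihq =>
    by_cases hb : b.Holds s
    · obtain ⟨t, ht, h⟩ := ihp hp.1 s
      refine ⟨_, Nat.add_le_add_left (ht.trans (Nat.le_add_right _ _)) _, ?_⟩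
      rw [Program.run, if_pos hb]
      exact .branchTrue hb h
    · obtain ⟨t, ht, h⟩ := ihq hp.2 s
      refine ⟨_, Nat.add_le_add_left (ht.trans (Nat.le_add_left _ _)) _, ?_⟩
      rw [Program.run, if_neg hb]
      exact .branchFalse hb h
  | loop b p => exact hp.elim

/-- A loop with an invariant and a decreasing measure. -/
lemma runs_loop {b : Test} {p : Program} (hp : p.LoopFree) (Inv : State → Prop) (μ : State → ℕ)
    (step : ∀ s, Inv s → b.Holds s → Inv (p.run s) ∧ μ (p.run s) < μ s) (s : State)
    (hs : Inv s) :
    ∃ t s', t ≤ μ s * (b.cost + p.time) + b.cost ∧ Runs (.loop b p) s t s' ∧ Inv s' ∧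
      ¬ b.Holds s' := by
  induction hm : μ s using Nat.strong_induction_on generalizing s with
  | _ m ih =>
    by_cases hb : b.Holds s
    · obtain ⟨h1, h2⟩ := step s hs hb
      obtain ⟨t, ht, hr⟩ := hp.runs s
      obtain ⟨t', s', ht', hr', hi, hn⟩ := ih _ (hm ▸ h2) _ h1 rfl
      refine ⟨_, s', ?_, .loopStep hb hr hr', hi, hn⟩
      have : (μ (p.run s) + 1) * (b.cost + p.time) ≤ m * (b.cost + p.time) :=
        Nat.mul_le_mul_right _ (hm ▸ h2)
      rw [Nat.add_mul, one_mul] at this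
      omega
    · exact ⟨_, s, Nat.le_add_left _ _, .loopDone hb, hs, hb⟩

/-- Run programs one after the other. -/
def Program.block (l : List Program) : Program := l.foldr .seq .skip

@[simp] lemma Program.block_nil : Program.block [] = .skip := rfl

@[simp] lemma Program.block_cons (p : Program) (l : List Program) :
    Program.block (p :: l) = .seq p (Program.block l) := rfl

/-- Powers with a fixed exponent. -/
def RealExpr.pow (e : RealExpr) : ℕ → RealExpr
  | 0 => .lit 1
  | k + 1 => .mul (e.pow k) e

@[simp] lemma RealExpr.eval_pow (e : RealExpr) (k : ℕ) (s : State) :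
    (e.pow k).eval s = e.eval s ^ k := by
  induction k with
  | zero => simp [RealExpr.pow, RealExpr.eval]
  | succ k ih => simp [RealExpr.pow, RealExpr.eval, ih, pow_succ]

/-! ### The program -/

/-- Compute the degree of every vertex and the sum of its neighbours. -/
def countBody : Program := .block [
  .putNat 2 (.get 0 (.var 1)) (.add (.get 2 (.get 0 (.var 1))) (.lit 1)),
  .putNat 2 (.get 1 (.var 1)) (.add (.get 2 (.get 1 (.var 1))) (.lit 1)),
  .putNat 3 (.get 0 (.var 1)) (.add (.get 3 (.get 0 (.var 1))) (.get 1 (.var 1))),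
  .putNat 3 (.get 1 (.var 1)) (.add (.get 3 (.get 1 (.var 1))) (.get 0 (.var 1))),
  .setNat 1 (.add (.var 1) (.lit 1))]

/-- Remove the vertex held in variable `2`, which is a leaf, and go to its neighbour. -/
def pruneLeaf : Program := .block [
  .setNat 4 (.get 3 (.var 2)),
  .putNat 4 (.var 3) (.var 2),
  .putNat 5 (.var 3) (.var 4),
  .putNat 2 (.var 2) (.lit 0),
  .putNat 2 (.var 4) (.sub (.get 2 (.var 4)) (.lit 1)),
  .putNat 3 (.var 4) (.sub (.get 3 (.var 4)) (.var 2)),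
  .setNat 3 (.add (.var 3) (.lit 1)),
  .setNat 2 (.var 4)]

/-- Go to the next vertex in numerical order. -/
def nextVertex : Program := .block [
  .setNat 1 (.add (.var 1) (.lit 1)),
  .setNat 2 (.var 1)]

/-- The body of the loop that removes leaves. -/
def pruneBody : Program :=
  .branch (.natEq (.get 2 (.var 2)) (.lit 1)) pruneLeaf nextVertex

/-- The first coordinate of a witness, with `x` in the real variables `1` and `2` and the new leaf in
the real variables `3` and `4`. -/
def witnessExpr₁ (P K : ℚ) (k : ℕ) : RealExpr :=
  .add (.add (.var 3) (.mul (.lit (1 / 16)) (.sub (.mul (.lit P) (.sub (.var 3) (.var 1)))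
    (.mul (.lit K) (.mul (.pow (.var 0) 2) (.sub (.var 4) (.var 2)))))))
    (.pow (.pow (.pow (.var 0) 63) (10 ^ k)) 5)

/-- The second coordinate of a witness. -/
def witnessExpr₂ (P K : ℚ) (k : ℕ) : RealExpr :=
  .add (.add (.var 4) (.mul (.lit (1 / 16)) (.add (.mul (.lit P) (.sub (.var 4) (.var 2)))
    (.mul (.lit K) (.mul (.pow (.var 0) 2) (.sub (.var 3) (.var 1)))))))
    (.pow (.pow (.pow (.var 0) 63) (10 ^ k)) 10)

/-- Find out which leaf was removed last, and compute its location. -/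
def attachRead : Program := .block [
  .setNat 3 (.sub (.var 3) (.lit 1)),
  .setNat 4 (.get 4 (.var 3)),
  .setNat 5 (.get 5 (.var 3)),
  .setReal 1 (.get 0 (.var 5)),
  .setReal 2 (.get 1 (.var 5)),
  .setReal 3 (.add (.add (.var 1) (.pow (.var 0) 6)) (.pow (.pow (.var 0) 6) 5)),
  .setReal 4 (.add (.sub (.var 2) (.pow (.var 0) 4)) (.pow (.pow (.var 0) 6) 10))]

/-- Store the leaf and its witnesses. -/
def attachWrite : Program := .block [
  .putReal 0 (.var 4) (.var 3),
  .putReal 1 (.var 4) (.var 4),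
  .putReal 2 (.var 0) (witnessExpr₁ (-8) (-3) 0),
  .putReal 3 (.var 0) (witnessExpr₂ (-8) (-3) 0),
  .putReal 2 (.add (.var 0) (.lit 1)) (witnessExpr₁ 8 5 1),
  .putReal 3 (.add (.var 0) (.lit 1)) (witnessExpr₂ 8 5 1),
  .putReal 2 (.add (.var 0) (.lit 2)) (witnessExpr₁ 0 (-16) 2),
  .putReal 3 (.add (.var 0) (.lit 2)) (witnessExpr₂ 0 (-16) 2),
  .setNat 0 (.add (.var 0) (.lit 3)),
  .setReal 0 (.pow (.pow (.var 0) 63) (10 ^ 3))]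

/-- Attach the leaf that was removed last. -/
def attachBody : Program := .seq attachRead attachWrite

/-- Start with an empty set of witnesses. -/
def initAttach : Program := .block [.setNat 0 (.lit 0), .setReal 0 (.lit (1 / 1000000))]

/-- The loop computing degrees. -/
def countLoop : Program := .loop (.natLt (.var 1) (.sub (.var 0) (.lit 1))) countBody

/-- The loop removing leaves. -/
def pruneLoop : Program := .loop (.natLt (.var 1) (.var 0)) pruneBody

/-- The loop attaching leaves. -/
def attachLoop : Program := .loop (.natLt (.lit 0) (.var 3)) attachBody

/-- The program that computes a realization of a tree. -/
def treeProgram : Program :=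
  .seq countLoop (.seq (.setNat 1 (.lit 0)) (.seq pruneLoop (.seq initAttach attachLoop)))

end RealRAM

/-! ### Removing leaves from a tree -/

section Peel

variable {n : ℕ} {G : SimpleGraph (Fin n)}

open Classical in
/-- The sum of `f` over the neighbours of `v` in `B`. -/
noncomputable def nbrSum (G : SimpleGraph (Fin n)) (f : Fin n → ℕ) (B : Finset (Fin n))
    (v : Fin n) : ℕ :=
  ∑ u ∈ B, if G.Adj v u then f u else 0

/-- `l` lists pairs of a leaf and its neighbour, in the reverse of an order in which the leaves can
be removed, one after the other, leaving the vertices in `B`. -/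
inductive Peel (G : SimpleGraph (Fin n)) : List (Fin n × Fin n) → Finset (Fin n) → Prop
  | nil : Peel G [] Finset.univ
  | cons {l : List (Fin n × Fin n)} {B : Finset (Fin n)} {u v : Fin n} (h : Peel G l B)
      (hu : u ∈ B) (hv : v ∈ B) (huv : G.Adj u v) (honly : ∀ w ∈ B, G.Adj w v → w = u) :
      Peel G ((v, u) :: l) (B.erase v)

open Classical in
lemma nbrSum_erase (f : Fin n → ℕ) {B : Finset (Fin n)} {v : Fin n} (hv : v ∈ B) (w : Fin n) :
    nbrSum G f B w = nbrSum G f (B.erase v) w + if G.Adj w v then f v else 0 := by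
  rw [nbrSum, nbrSum, Finset.sum_erase_add _ _ hv]

lemma nbrSum_eq_of_only {f : Fin n → ℕ} {B : Finset (Fin n)} {u v : Fin n} (hu : u ∈ B)
    (huv : G.Adj u v) (honly : ∀ w ∈ B, G.Adj w v → w = u) : nbrSum G f B v = f u := by
  classical
  rw [nbrSum, Finset.sum_eq_single_of_mem u hu, if_pos huv.symm]
  intro w hw hne
  exact if_neg fun h => hne (honly w hw h.symm)

lemma exists_only_of_nbrSum_eq_one {B : Finset (Fin n)} {v : Fin n}
    (h : nbrSum G (fun _ => 1) B v = 1) :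
    ∃ u ∈ B, G.Adj u v ∧ ∀ w ∈ B, G.Adj w v → w = u := by
  classical
  rw [nbrSum, ← Finset.card_filter, Finset.card_eq_one] at h
  obtain ⟨u, hu⟩ := h
  have key : ∀ w, w ∈ B ∧ G.Adj v w ↔ w = u := fun w => by
    rw [← Finset.mem_filter, hu, Finset.mem_singleton]
  obtain ⟨h1, h2⟩ := (key u).2 rfl
  exact ⟨u, h1, h2.symm, fun w hw hadj => (key w).1 ⟨hw, hadj.symm⟩⟩

lemma Peel.card {l : List (Fin n × Fin n)} {B : Finset (Fin n)} (h : Peel G l B) :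
    B.card + l.length = n := by
  induction h with
  | nil => simp
  | cons h hu hv huv honly ih =>
    rw [Finset.card_erase_of_mem hv, List.length_cons]
    have := Finset.card_pos.2 ⟨_, hv⟩
    omega

lemma Peel.nonempty (hn : 0 < n) {l : List (Fin n × Fin n)} {B : Finset (Fin n)}
    (h : Peel G l B) : B.Nonempty := by
  cases h with
  | nil => exact ⟨⟨0, hn⟩, Finset.mem_univ _⟩
  | cons h hu hv huv honly => exact ⟨_, Finset.mem_erase.2 ⟨huv.ne, hu⟩⟩

/-- What is left stays connected. -/
lemma Peel.connected (hG : G.Connected) {l : List (Fin n × Fin n)} {B : Finset (Fin n)}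
    (h : Peel G l B) (C : Finset (Fin n)) (hC : C ⊆ B) (hne : C.Nonempty) (hne' : C ≠ B) :
    ∃ a ∈ C, ∃ b ∈ B, b ∉ C ∧ G.Adj a b := by
  induction h generalizing C with
  | nil =>
    obtain ⟨a, ha⟩ := hne
    obtain ⟨b, hb⟩ : ∃ b, b ∉ C := by
      by_contra! hall
      exact hne' (Finset.eq_univ_iff_forall.2 hall)
    obtain ⟨w⟩ := hG.preconnected a b
    obtain ⟨d, -, h1, h2⟩ := w.exists_boundary_dart (C : Set (Fin n)) ha hb
    exact ⟨d.fst, h1, d.snd, Finset.mem_univ _, h2, d.adj⟩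
  | @cons l B u v h hu hv huv honly ih =>
    have hvC : v ∉ C := fun hv' => (Finset.mem_erase.1 (hC hv')).1 rfl
    have hCB : C ⊆ B := hC.trans (Finset.erase_subset _ _)
    -- The removed leaf `v` is put on the same side of the cut as its only neighbour `u`; then no
    -- crossing edge ends at `v`.
    by_cases huC : u ∈ C
    · obtain ⟨a, ha, b, hb, hbC, hab⟩ := ih (insert v C)
        (Finset.insert_subset hv hCB) (Finset.insert_nonempty _ _) fun e => hne' (by
          rw [← e, Finset.erase_insert hvC])
      rw [Finset.mem_insert, not_or] at hbC
      rcases Finset.mem_insert.1 ha with rfl | ha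
      · exact absurd (honly b hb hab.symm ▸ huC) hbC.2
      · exact ⟨a, ha, b, Finset.mem_erase.2 ⟨hbC.1, hb⟩, hbC.2, hab⟩
    · obtain ⟨a, ha, b, hb, hbC, hab⟩ := ih C hCB hne fun e => hvC (e ▸ hv)
      refine ⟨a, ha, b, Finset.mem_erase.2 ⟨?_, hb⟩, hbC, hab⟩
      rintro rfl
      exact huC (honly a (hCB ha) hab ▸ ha)

/-- The degree sum of a tree on `B` is `2 * (B.card - 1)`, and removing a leaf lowers it by two: one
for the leaf, one for its neighbour. -/
lemma Peel.sum_degrees (hG : G.IsTree) {l : List (Fin n × Fin n)} {B : Finset (Fin n)}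
    (h : Peel G l B) :
    ∑ v ∈ B, nbrSum G (fun _ => 1) B v + 2 * l.length + 2 = 2 * n := by
  classical
  induction h with
  | nil =>
    have h1 := hG.card_edgeFinset
    have h2 := G.sum_degrees_eq_twice_card_edges
    rw [Fintype.card_fin] at h1
    have h3 : ∀ v, nbrSum G (fun _ => 1) Finset.univ v = G.degree v := fun v => by
      rw [nbrSum, ← Finset.card_filter, ← SimpleGraph.card_neighborFinset_eq_degree,
        SimpleGraph.neighborFinset_eq_filter]
    simp only [h3, h2, List.length_nil]
    omega
  | @cons l B u v h hu hv huv honly ih =>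
    rw [← Finset.sum_erase_add _ _ hv, nbrSum_eq_of_only hu huv honly,
      Finset.sum_congr rfl fun w _ => nbrSum_erase (fun _ => 1) hv w,
      Finset.sum_add_distrib] at ih
    have : ∑ w ∈ B.erase v, (if G.Adj w v then 1 else 0) = 1 := by
      rw [Finset.sum_eq_single_of_mem u (Finset.mem_erase.2 ⟨huv.ne, hu⟩), if_pos huv]
      intro w hw hne
      exact if_neg fun h => hne (honly w (Finset.mem_of_mem_erase hw) h)
    rw [List.length_cons]
    omega

/-- If no leaf is left, a single vertex is left. -/
lemma Peel.card_eq_one (hG : G.IsTree) {l : List (Fin n × Fin n)} {B : Finset (Fin n)}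
    (hn : 0 < n) (h : Peel G l B) (hdeg : ∀ v ∈ B, nbrSum G (fun _ => 1) B v ≠ 1) :
    B.card = 1 := by
  classical
  by_contra hB
  have hpos := (h.nonempty hn).card_pos
  have h2 : ∀ v ∈ B, 2 ≤ nbrSum G (fun _ => 1) B v := by
    intro v hv
    obtain ⟨a, ha, b, hb, -, hab⟩ := h.connected hG.connected {v} (by simpa using hv)
      (by simp) (by rintro rfl; simp at hB)
    rw [Finset.mem_singleton] at ha
    subst ha
    have h1 : 1 ≤ nbrSum G (fun _ => 1) B a := by
      refine le_trans ?_ (Finset.single_le_sum (fun _ _ => Nat.zero_le _) hb)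
      rw [if_pos hab]
    have := hdeg a hv
    omega
  -- By connectedness no degree is zero, so without leaves the degree sum is at least `2 * B.card`,
  -- two more than it is.
  have h3 := Finset.sum_le_sum h2
  rw [Finset.sum_const, smul_eq_mul] at h3
  have h4 := h.sum_degrees hG
  have h5 := h.card
  omega

end Peel

/-! ### Degrees and neighbour sums read off the edge list. -/

section EdgeList

variable {n : ℕ} {G : SimpleGraph (Fin n)}

open Classical in
/-- The sum of `f` over the neighbours of `v` along the edges in `l`. -/
noncomputable def listNbrSum (l : List (Fin n × Fin n)) (f : Fin n → ℕ) (v : Fin n) : ℕ :=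
  ∑ u, if s(v, u) ∈ l.map (fun e => s(e.1, e.2)) then f u else 0

lemma listNbrSum_nil (f : Fin n → ℕ) (v : Fin n) : listNbrSum [] f v = 0 := by
  simp [listNbrSum]

/-- This is the update made by one round of the counting loop. The edge must be new to the list:
`listNbrSum` counts a repeated edge once, the machine would count it twice. -/
lemma listNbrSum_append {l : List (Fin n × Fin n)} {a b : Fin n} (hab : a ≠ b)
    (hl : s(a, b) ∉ l.map (fun e => s(e.1, e.2))) (f : Fin n → ℕ) (v : Fin n) :
    listNbrSum (l ++ [(a, b)]) f v =
      listNbrSum l f v + (if v = a then f b else 0) + (if v = b then f a else 0) := by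
  classical
  have h1 : (if v = a then f b else 0) = ∑ u, if v = a ∧ u = b then f u else 0 := by
    by_cases h : v = a <;> simp [h]
  have h2 : (if v = b then f a else 0) = ∑ u, if v = b ∧ u = a then f u else 0 := by
    by_cases h : v = b <;> simp [h]
  rw [h1, h2, listNbrSum, listNbrSum, ← Finset.sum_add_distrib, ← Finset.sum_add_distrib]
  refine Finset.sum_congr rfl fun u _ => ?_
  simp only [List.map_append, List.mem_append]
  by_cases hm : s(v, u) ∈ l.map (fun e => s(e.1, e.2))
  · have n1 : ¬ (v = a ∧ u = b) := by rintro ⟨rfl, rfl⟩; exact hl hm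
    have n2 : ¬ (v = b ∧ u = a) := by rintro ⟨rfl, rfl⟩; exact hl (Sym2.eq_swap ▸ hm)
    simp only [hm, n1, n2, true_or, if_true, if_false, add_zero]
  · simp only [hm, List.map_cons, List.map_nil, List.mem_singleton, false_or, if_false, zero_add]
    by_cases h1 : v = a ∧ u = b
    · obtain ⟨rfl, rfl⟩ := h1
      simp [hab]
    · by_cases h2 : v = b ∧ u = a
      · obtain ⟨rfl, rfl⟩ := h2
        simp [hab.symm, Sym2.eq_swap]
      · rw [if_neg h1, if_neg h2, if_neg]
        rw [Sym2.eq_iff]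
        tauto

lemma IsEdgeList.listNbrSum_eq {L : List (Fin n × Fin n)} (hL : IsEdgeList G L)
    (f : Fin n → ℕ) (v : Fin n) : listNbrSum L f v = nbrSum G f Finset.univ v := by
  classical
  rw [listNbrSum, nbrSum]
  refine Finset.sum_congr rfl fun u _ => ?_
  rw [if_congr (hL.2 s(v, u)) rfl rfl]
  simp

lemma IsEdgeList.length_add_one {L : List (Fin n × Fin n)} (hL : IsEdgeList G L)
    (hG : G.IsTree) : L.length + 1 = n := by
  classical
  have h1 := hG.card_edgeFinset
  rw [Fintype.card_fin] at h1
  have h2 : (L.map fun e => s(e.1, e.2)).toFinset = G.edgeFinset := by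
    ext e
    rw [List.mem_toFinset, hL.2, SimpleGraph.mem_edgeFinset]
  rw [← h2, List.toFinset_card_of_nodup hL.1, List.length_map] at h1
  exact h1

lemma IsEdgeList.adj {L : List (Fin n × Fin n)} (hL : IsEdgeList G L) {e : Fin n × Fin n}
    (he : e ∈ L) : G.Adj e.1 e.2 := by
  have := (hL.2 s(e.1, e.2)).1 (List.mem_map_of_mem he)
  simpa using this

end EdgeList

/-! ### Correctness and running time of counting and pruning. -/

namespace RealRAM

variable {n : ℕ} {G : SimpleGraph (Fin n)}

/-- The memory while degrees are computed, after the edges in `l`. -/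
structure CountInv (n : ℕ) (L : List (Fin n × Fin n)) (s : State) : Prop where
  n_eq : s.nvar 0 = n
  cur : s.nvar 2 = 0
  cnt : s.nvar 3 = 0
  fst : s.narr 0 = (inputState n L).narr 0
  snd : s.narr 1 = (inputState n L).narr 1
  le : s.nvar 1 ≤ L.length
  deg : ∀ v : Fin n, s.narr 2 v = listNbrSum (L.take (s.nvar 1)) (fun _ => 1) v
  sum : ∀ v : Fin n, s.narr 3 v = listNbrSum (L.take (s.nvar 1)) (fun u => u) v
  real : s.rarr = fun _ _ => 0

lemma CountInv.step {L : List (Fin n × Fin n)} (hG : G.IsTree) (hL : IsEdgeList G L) {s : State}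
    (h : CountInv n L s) (hi : s.nvar 1 < n - 1) :
    CountInv n L (countBody.run s) ∧ (countBody.run s).nvar 1 = s.nvar 1 + 1 := by
  have hlen := hL.length_add_one hG
  have hi' : s.nvar 1 < L.length := by omega
  obtain ⟨⟨a, b⟩, hab⟩ : ∃ e, L[s.nvar 1] = e := ⟨_, rfl⟩
  have ha : s.narr 0 (s.nvar 1) = a := by
    rw [h.fst]; simp [inputState, hi', hab]
  have hb : s.narr 1 (s.nvar 1) = b := by
    rw [h.snd]; simp [inputState, hi', hab]
  have hadj : G.Adj a b := by
    have := hL.adj (List.getElem_mem hi')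
    rwa [hab] at this
  have htake : L.take (s.nvar 1 + 1) = L.take (s.nvar 1) ++ [(a, b)] := by
    rw [List.take_succ_eq_append_getElem hi', hab]
  have hnot : s(a, b) ∉ (L.take (s.nvar 1)).map (fun e => s(e.1, e.2)) := by
    have h1 : ((L.take (s.nvar 1 + 1)).map (fun e => s(e.1, e.2))).Nodup :=
      hL.1.sublist ((List.take_sublist _ _).map _)
    rw [htake, List.map_append, List.nodup_append] at h1
    exact fun hm => h1.2.2 _ hm _ (by simp) rfl
  have key := fun f v => listNbrSum_append hadj.ne hnot f v
  have hne : (a : ℕ) ≠ b := fun e => hadj.ne (Fin.ext e)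
  refine ⟨⟨?_, ?_, ?_, ?_, ?_, ?_, ?_, ?_, ?_⟩, ?_⟩
  · simp [countBody, Program.run, h.n_eq]
  · simp [countBody, Program.run, h.cur]
  · simp [countBody, Program.run, h.cnt]
  · simp [countBody, Program.run, h.fst]
  · simp [countBody, Program.run, h.snd]
  · simp [countBody, Program.run, NatExpr.eval]; omega
  · intro v
    have e : (countBody.run s).nvar 1 = s.nvar 1 + 1 := by
      simp [countBody, Program.run, NatExpr.eval]
    rw [e, htake, key, ← h.deg]
    simp only [countBody, Program.block_cons, Program.block_nil, Program.run, NatExpr.eval,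
      Function.update_apply, ha]
    by_cases h1 : v = a
    · subst h1
      simp [hne, hadj.ne, hb]
    · by_cases h2 : v = b
      · subst h2
        simp [hne.symm, hadj.ne.symm, hb]
      · have h1' : (v : ℕ) ≠ a := fun e => h1 (Fin.ext e)
        have h2' : (v : ℕ) ≠ b := fun e => h2 (Fin.ext e)
        simp [h1, h2, h1', h2', hb]
  · intro v
    have e : (countBody.run s).nvar 1 = s.nvar 1 + 1 := by
      simp [countBody, Program.run, NatExpr.eval]
    rw [e, htake, key, ← h.sum]
    simp only [countBody, Program.block_cons, Program.block_nil, Program.run, NatExpr.eval,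
      Function.update_apply, ha]
    by_cases h1 : v = a
    · subst h1
      simp [hne, hadj.ne, ha, hb]
    · by_cases h2 : v = b
      · subst h2
        simp [hne.symm, hadj.ne.symm, ha, hb]
      · have h1' : (v : ℕ) ≠ a := fun e => h1 (Fin.ext e)
        have h2' : (v : ℕ) ≠ b := fun e => h2 (Fin.ext e)
        simp [h1, h2, h1', h2', ha, hb]
  · simp [countBody, Program.run, h.real]
  · simp [countBody, Program.run, NatExpr.eval]

/-- The arrays `a` and `b` hold the list `l` of pairs, the head of the list being stored last. -/
def Stored {n : ℕ} (a b : ℕ → ℕ) : List (Fin n × Fin n) → Prop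
  | [] => True
  | (v, u) :: l => a l.length = v ∧ b l.length = u ∧ Stored a b l

lemma Stored.congr {a b a' b' : ℕ → ℕ} {l : List (Fin n × Fin n)} (h : Stored a b l)
    (ha : ∀ i < l.length, a' i = a i) (hb : ∀ i < l.length, b' i = b i) : Stored a' b' l := by
  induction l with
  | nil => trivial
  | cons e l ih =>
    obtain ⟨h1, h2, h3⟩ := h
    have hl : l.length < (e :: l).length := by simp
    exact ⟨(ha _ hl).trans h1, (hb _ hl).trans h2,
      ih h3 (fun i hi => ha i (hi.trans hl)) (fun i hi => hb i (hi.trans hl))⟩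

/-- The memory while leaves are removed. -/
structure PruneInv (G : SimpleGraph (Fin n)) (l : List (Fin n × Fin n)) (B : Finset (Fin n))
    (s : State) : Prop where
  n_eq : s.nvar 0 = n
  le : s.nvar 1 ≤ n
  cnt : s.nvar 3 = l.length
  peel : Peel G l B
  stored : Stored (s.narr 4) (s.narr 5) l
  deg : ∀ v ∈ B, s.narr 2 v = nbrSum G (fun _ => 1) B v
  deg_zero : ∀ v ∉ B, s.narr 2 v = 0
  sum : ∀ v ∈ B, s.narr 3 v = nbrSum G (fun u => u) B v
  cur_lt : s.nvar 1 < n → s.nvar 2 < n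
  cur_eq : s.nvar 1 = n → s.nvar 2 = n
  done : ∀ v : Fin n, (v : ℕ) ≤ s.nvar 1 → (v : ℕ) ≠ s.nvar 2 → s.narr 2 v ≠ 1
  real : s.rarr = fun _ _ => 0

lemma PruneInv.step_leaf {l : List (Fin n × Fin n)} {B : Finset (Fin n)} {s : State}
    (h : PruneInv G l B s) (hi : s.nvar 1 < n) (hd : s.narr 2 (s.nvar 2) = 1) :
    ∃ l' B', PruneInv G l' B' (pruneLeaf.run s) ∧ l'.length = l.length + 1 ∧
      (pruneLeaf.run s).nvar 1 = s.nvar 1 := by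
  obtain ⟨v, hv⟩ : ∃ v : Fin n, (v : ℕ) = s.nvar 2 := ⟨⟨_, h.cur_lt hi⟩, rfl⟩
  rw [← hv] at hd
  have hvB : v ∈ B := by
    by_contra hvB
    rw [h.deg_zero v hvB] at hd
    exact zero_ne_one hd
  obtain ⟨u, hu, huv, honly⟩ := exists_only_of_nbrSum_eq_one ((h.deg v hvB).symm.trans hd)
  -- The neighbour sum of a leaf is the label of its only remaining neighbour.
  have hs : s.narr 3 v = u := (h.sum v hvB).trans (nbrSum_eq_of_only hu huv honly)
  have huv' : (u : ℕ) ≠ v := fun e => huv.ne (Fin.ext e)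
  have n2 : (pruneLeaf.run s).narr 2 =
      Function.update (Function.update (s.narr 2) v 0) u (s.narr 2 u - 1) := by
    simp [pruneLeaf, Program.run, NatExpr.eval, ← hv, hs, huv']
  have n3 : (pruneLeaf.run s).narr 3 = Function.update (s.narr 3) u (s.narr 3 u - v) := by
    simp [pruneLeaf, Program.run, NatExpr.eval, ← hv, hs]
  have e1 : (pruneLeaf.run s).nvar 1 = s.nvar 1 := by
    simp [pruneLeaf, Program.run, NatExpr.eval]
  have e2 : (pruneLeaf.run s).nvar 2 = u := by
    simp [pruneLeaf, Program.run, NatExpr.eval, ← hv, hs]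
  have others : ∀ (f : Fin n → ℕ), ∀ w ∈ B.erase v, w ≠ u →
      nbrSum G f (B.erase v) w = nbrSum G f B w := by
    intro f w hw hwu
    rw [nbrSum_erase f hvB w, if_neg, add_zero]
    exact fun hadj => hwu (honly w (Finset.mem_of_mem_erase hw) hadj)
  have parent : ∀ (f : Fin n → ℕ), nbrSum G f (B.erase v) u = nbrSum G f B u - f v := by
    intro f
    rw [nbrSum_erase f hvB u, if_pos huv, Nat.add_sub_cancel]
  refine ⟨(v, u) :: l, B.erase v, ⟨?_, ?_, ?_, ?_, ?_, ?_, ?_, ?_, ?_, ?_, ?_, ?_⟩, rfl, e1⟩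
  · simp [pruneLeaf, Program.run, h.n_eq]
  · rw [e1]; exact h.le
  · simp [pruneLeaf, Program.run, NatExpr.eval, h.cnt]
  · exact .cons h.peel hu hvB huv honly
  · have n4 : (pruneLeaf.run s).narr 4 = Function.update (s.narr 4) l.length v := by
      simp [pruneLeaf, Program.run, NatExpr.eval, ← hv, h.cnt]
    have n5 : (pruneLeaf.run s).narr 5 = Function.update (s.narr 5) l.length u := by
      simp [pruneLeaf, Program.run, NatExpr.eval, ← hv, h.cnt, hs]
    rw [n4, n5]
    exact ⟨by simp, by simp, h.stored.congr (fun i hi => Function.update_of_ne hi.ne _ _)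
      (fun i hi => Function.update_of_ne hi.ne _ _)⟩
  · intro w hw
    rw [n2]
    obtain ⟨hwv, hwB⟩ := Finset.mem_erase.1 hw
    by_cases hwu : w = u
    · subst hwu
      rw [Function.update_self, parent, h.deg w hu]
    · rw [Function.update_of_ne (Fin.val_ne_of_ne hwu), Function.update_of_ne
        (Fin.val_ne_of_ne hwv), others _ w hw hwu, h.deg w hwB]
  · intro w hw
    rw [n2]
    have hwu : w ≠ u := by
      rintro rfl
      exact hw (Finset.mem_erase.2 ⟨huv.ne, hu⟩)
    rw [Function.update_of_ne (Fin.val_ne_of_ne hwu)]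
    by_cases hwv : w = v
    · rw [hwv, Function.update_self]
    · rw [Function.update_of_ne (Fin.val_ne_of_ne hwv)]
      exact h.deg_zero w fun hwB => hw (Finset.mem_erase.2 ⟨hwv, hwB⟩)
  · intro w hw
    rw [n3]
    obtain ⟨hwv, hwB⟩ := Finset.mem_erase.1 hw
    by_cases hwu : w = u
    · subst hwu
      rw [Function.update_self, parent, h.sum w hu]
    · rw [Function.update_of_ne (Fin.val_ne_of_ne hwu), others _ w hw hwu, h.sum w hwB]
  · intro _
    rw [e2]; exact u.2
  · rw [e1]
    intro e
    omega
  -- Only the neighbour `u` loses degree without being removed, so only `u` can have become a leaf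
  -- behind the pointer, and `u` is the new current vertex.
  · intro w hw hwu
    rw [e1] at hw
    rw [e2] at hwu
    rw [n2, Function.update_of_ne hwu]
    by_cases hwv : w = v
    · rw [hwv, Function.update_self]; exact zero_ne_one
    · rw [Function.update_of_ne (Fin.val_ne_of_ne hwv)]
      exact h.done w hw (hv ▸ Fin.val_ne_of_ne hwv)
  · simp [pruneLeaf, Program.run, h.real]

lemma PruneInv.step_next {l : List (Fin n × Fin n)} {B : Finset (Fin n)} {s : State}
    (h : PruneInv G l B s) (hi : s.nvar 1 < n) (hd : s.narr 2 (s.nvar 2) ≠ 1) :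
    PruneInv G l B (nextVertex.run s) ∧ (nextVertex.run s).nvar 1 = s.nvar 1 + 1 := by
  have e1 : (nextVertex.run s).nvar 1 = s.nvar 1 + 1 := by
    simp [nextVertex, Program.run, NatExpr.eval]
  have e2 : (nextVertex.run s).nvar 2 = s.nvar 1 + 1 := by
    simp [nextVertex, Program.run, NatExpr.eval]
  have ea : (nextVertex.run s).narr = s.narr := by
    simp [nextVertex, Program.run]
  refine ⟨⟨?_, ?_, ?_, h.peel, ?_, ?_, ?_, ?_, ?_, ?_, ?_, ?_⟩, e1⟩
  · simp [nextVertex, Program.run, h.n_eq]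
  · rw [e1]; exact hi
  · simp [nextVertex, Program.run, h.cnt]
  · rw [ea]; exact h.stored
  · rw [ea]; exact h.deg
  · rw [ea]; exact h.deg_zero
  · rw [ea]; exact h.sum
  · rw [e1, e2]; exact id
  · rw [e1, e2]; exact id
  · rw [e1, e2, ea]
    intro v hv hne
    by_cases hvc : (v : ℕ) = s.nvar 2
    · rwa [hvc]
    · exact h.done v (by omega) hvc
  · simp [nextVertex, Program.run, h.real]

/-- Every round either removes a vertex or advances the pointer, and neither happens more than `n`
times. -/
lemma runs_pruneLoop (hn : 0 < n) {s : State}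
    (h : PruneInv G [] Finset.univ s) (hs : s.nvar 1 = 0) :
    ∃ t s' l B, t ≤ 2 * n * ((Test.natLt (.var 1) (.var 0)).cost + pruneBody.time)
      + (Test.natLt (.var 1) (.var 0)).cost ∧ Runs pruneLoop s t s' ∧ PruneInv G l B s' ∧
      s'.nvar 1 = n := by
  have step : ∀ s, (∃ l B, PruneInv G l B s) → (Test.natLt (.var 1) (.var 0)).Holds s →
      (∃ l B, PruneInv G l B (pruneBody.run s)) ∧ (n - (pruneBody.run s).nvar 1) +
        (n - (pruneBody.run s).nvar 3) < (n - s.nvar 1) + (n - s.nvar 3) := by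
    rintro s ⟨l, B, hI⟩ hb
    simp only [Test.Holds, NatExpr.eval, hI.n_eq] at hb
    by_cases hd : s.narr 2 (s.nvar 2) = 1
    · have e : pruneBody.run s = pruneLeaf.run s := by
        rw [pruneBody, Program.run]; exact if_pos hd
      obtain ⟨l', B', hI', hl, h1⟩ := hI.step_leaf hb hd
      rw [e]
      refine ⟨⟨l', B', hI'⟩, ?_⟩
      have := hI'.peel.card
      have := (hI'.peel.nonempty hn).card_pos
      rw [hI'.cnt, hI.cnt, h1]
      omega
    · have e : pruneBody.run s = nextVertex.run s := by
        rw [pruneBody, Program.run]; exact if_neg hd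
      obtain ⟨hI', h1⟩ := hI.step_next hb hd
      rw [e]
      refine ⟨⟨l, B, hI'⟩, ?_⟩
      rw [hI'.cnt, hI.cnt, h1]
      omega
  obtain ⟨t, s', ht, hr, ⟨l, B, hI⟩, hb⟩ := runs_loop (b := .natLt (.var 1) (.var 0))
    (p := pruneBody) (by simp [pruneBody, pruneLeaf, nextVertex, Program.LoopFree])
    (fun s => ∃ l B, PruneInv G l B s) (fun s => (n - s.nvar 1) + (n - s.nvar 3)) step s ⟨_, _, h⟩
  · refine ⟨t, s', l, B, ht.trans ?_, hr, hI, ?_⟩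
    · rw [hs, h.cnt]
      simp [two_mul]
    · simp only [Test.Holds, NatExpr.eval, hI.n_eq] at hb
      exact le_antisymm hI.le (not_lt.1 hb)

lemma runs_countLoop {L : List (Fin n × Fin n)} (hG : G.IsTree) (hL : IsEdgeList G L) :
    ∃ t s', t ≤ n * ((Test.natLt (.var 1) (.sub (.var 0) (.lit 1))).cost + countBody.time)
      + (Test.natLt (.var 1) (.sub (.var 0) (.lit 1))).cost ∧
      Runs countLoop (inputState n L) t s' ∧ CountInv n L s' ∧ s'.nvar 1 = L.length := by
  have hlen := hL.length_add_one hG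
  have h0 : CountInv n L (inputState n L) := by
    refine ⟨rfl, rfl, rfl, rfl, rfl, Nat.zero_le _, fun v => ?_, fun v => ?_, rfl⟩
    · exact (listNbrSum_nil _ v).symm
    · exact (listNbrSum_nil _ v).symm
  have step : ∀ s, CountInv n L s →
      (Test.natLt (.var 1) (.sub (.var 0) (.lit 1))).Holds s →
      CountInv n L (countBody.run s) ∧ n - (countBody.run s).nvar 1 < n - s.nvar 1 := by
    intro s hI hb
    simp only [Test.Holds, NatExpr.eval, hI.n_eq] at hb
    obtain ⟨h1, h2⟩ := hI.step hG hL hb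
    refine ⟨h1, ?_⟩
    rw [h2]
    omega
  obtain ⟨t, s', ht, hr, hI, hb⟩ := runs_loop (b := .natLt (.var 1) (.sub (.var 0) (.lit 1)))
    (p := countBody) (by simp [countBody, Program.LoopFree])
    (CountInv n L) (fun s => n - s.nvar 1) step _ h0
  · refine ⟨t, s', ht, hr, hI, ?_⟩
    simp only [Test.Holds, NatExpr.eval, hI.n_eq] at hb
    have := hI.le
    omega

lemma CountInv.pruneInv {L : List (Fin n × Fin n)} (hL : IsEdgeList G L)
    (hn : 0 < n) {s : State} (h : CountInv n L s) (hs : s.nvar 1 = L.length) :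
    PruneInv G [] Finset.univ ((Program.setNat 1 (.lit 0)).run s) := by
  have hd := h.deg
  have hS := h.sum
  rw [hs, List.take_length] at hd hS
  refine ⟨?_, ?_, ?_, .nil, trivial, ?_, ?_, ?_, ?_, ?_, ?_, ?_⟩
  · simp [Program.run, h.n_eq]
  · simp [Program.run, NatExpr.eval]
  · simp [Program.run, h.cnt]
  · intro v _
    rw [← hL.listNbrSum_eq, ← hd]; rfl
  · intro v hv
    exact absurd (Finset.mem_univ v) hv
  · intro v _
    rw [← hL.listNbrSum_eq, ← hS]; rfl
  · intro _
    simpa [Program.run, h.cur] using hn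
  · simp [Program.run, NatExpr.eval]
    omega
  · intro v hv hne
    simp [Program.run, NatExpr.eval, h.cur] at hv hne
    omega
  · simp [Program.run, h.real]

end RealRAM

/-! ### Correctness and running time of attaching, and the whole program. -/

namespace RealRAM

variable {n : ℕ} {G : SimpleGraph (Fin n)}

/-- The position of a vertex in the output. -/
def State.vertex (s : State) (v : Fin n) : ℝ × ℝ := (s.rarr 0 v, s.rarr 1 v)

/-- The witnesses in the output. -/
def State.witnesses (s : State) : Set (ℝ × ℝ) :=
  {w | ∃ j < s.nvar 0, w = (s.rarr 2 j, s.rarr 3 j)}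

/-- The memory while leaves are attached. -/
structure AttachInv (G : SimpleGraph (Fin n)) (l : List (Fin n × Fin n)) (B : Finset (Fin n))
    (s : State) : Prop where
  cnt : s.nvar 3 = l.length
  peel : Peel G l B
  stored : Stored (s.narr 4) (s.narr 5) l
  real : Realizes G (s.rvar 0) (B : Set (Fin n)) s.vertex s.witnesses

lemma eval_witnessExpr {s : State} {δ : ℝ} {x : ℝ × ℝ} (h0 : s.rvar 0 = δ) (h1 : s.rvar 1 = x.1)
    (h2 : s.rvar 2 = x.2) (h3 : s.rvar 3 = (leafPoint δ x).1) (h4 : s.rvar 4 = (leafPoint δ x).2)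
    (P K : ℤ) (k : ℕ) :
    (witnessExpr₁ P K k).eval s =
        (nearPoint ((δ ^ 63) ^ 10 ^ k) (witnessBase δ x (leafPoint δ x) P K)).1 ∧
      (witnessExpr₂ P K k).eval s =
        (nearPoint ((δ ^ 63) ^ 10 ^ k) (witnessBase δ x (leafPoint δ x) P K)).2 := by
  constructor <;>
  simp [witnessExpr₁, witnessExpr₂, RealExpr.eval, h0, h1, h2, h3, h4, nearPoint, witnessBase]

/-- The effect of the body of the last loop. -/
lemma attachBody_run {s : State} {x : ℝ × ℝ} {u v k m : ℕ} (hk : s.nvar 3 = k + 1)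
    (hm : s.nvar 0 = m) (hv : s.narr 4 k = v) (hu : s.narr 5 k = u)
    (hx : x = (s.rarr 0 u, s.rarr 1 u)) :
    (attachBody.run s).nvar 0 = m + 3 ∧ (attachBody.run s).nvar 3 = k ∧
    (attachBody.run s).narr = s.narr ∧ (attachBody.run s).rvar 0 = nextWidth (s.rvar 0) ∧
    (attachBody.run s).rarr 0 = Function.update (s.rarr 0) v (leafPoint (s.rvar 0) x).1 ∧
    (attachBody.run s).rarr 1 = Function.update (s.rarr 1) v (leafPoint (s.rvar 0) x).2 ∧
    (attachBody.run s).rarr 2 = Function.update (Function.update (Function.update (s.rarr 2) m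
      (leafWitness (s.rvar 0) x 0).1) (m + 1) (leafWitness (s.rvar 0) x 1).1) (m + 2)
      (leafWitness (s.rvar 0) x 2).1 ∧
    (attachBody.run s).rarr 3 = Function.update (Function.update (Function.update (s.rarr 3) m
      (leafWitness (s.rvar 0) x 0).2) (m + 1) (leafWitness (s.rvar 0) x 1).2) (m + 2)
      (leafWitness (s.rvar 0) x 2).2 := by
  subst hx hm
  have hs : attachBody.run s = attachWrite.run (attachRead.run s) := rfl
  have a0 : (attachRead.run s).rvar 0 = s.rvar 0 := by
    simp [attachRead, Program.run]
  have a1 : (attachRead.run s).rvar 1 = s.rarr 0 u := by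
    simp [attachRead, Program.run, RealExpr.eval, NatExpr.eval, hk, hu]
  have a2 : (attachRead.run s).rvar 2 = s.rarr 1 u := by
    simp [attachRead, Program.run, RealExpr.eval, NatExpr.eval, hk, hu]
  have a3 : (attachRead.run s).rvar 3 = (leafPoint (s.rvar 0) (s.rarr 0 u, s.rarr 1 u)).1 := by
    simp [attachRead, Program.run, RealExpr.eval, NatExpr.eval, hk, hu, leafPoint, nearPoint]
  have a4 : (attachRead.run s).rvar 4 = (leafPoint (s.rvar 0) (s.rarr 0 u, s.rarr 1 u)).2 := by
    simp [attachRead, Program.run, RealExpr.eval, NatExpr.eval, hk, hu, leafPoint, nearPoint]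
  have b0 : (attachRead.run s).nvar 0 = s.nvar 0 := by
    simp [attachRead, Program.run]
  have b3 : (attachRead.run s).nvar 3 = k := by
    simp [attachRead, Program.run, NatExpr.eval, hk]
  have b4 : (attachRead.run s).nvar 4 = v := by
    simp [attachRead, Program.run, NatExpr.eval, hk, hv]
  have bn : (attachRead.run s).narr = s.narr := by
    simp [attachRead, Program.run]
  have br : (attachRead.run s).rarr = s.rarr := by
    simp [attachRead, Program.run]
  rw [hs, ← bn, ← br]
  rw [← br] at a1 a2 a3 a4
  rw [← a0] at a3 a4 ⊢
  rw [← b0]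
  generalize attachRead.run s = s₁ at *
  -- The witness expressions read real variables only, and these stay unchanged until the last
  -- instruction replaces `δ`.
  have c₁ : ∀ (P K : ℚ) (i : ℕ) a b c, (witnessExpr₁ P K i).eval ⟨a, b, s₁.rvar, c⟩ =
      (witnessExpr₁ P K i).eval s₁ := by
    intros; simp [witnessExpr₁, RealExpr.eval]
  have c₂ : ∀ (P K : ℚ) (i : ℕ) a b c, (witnessExpr₂ P K i).eval ⟨a, b, s₁.rvar, c⟩ =
      (witnessExpr₂ P K i).eval s₁ := by
    intros; simp [witnessExpr₂, RealExpr.eval]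
  have w := eval_witnessExpr rfl a1 a2 a3 a4
  have w0 := w (-8) (-3) 0
  have w1 := w 8 5 1
  have w2 := w 0 (-16) 2
  simp only [Int.cast_neg, Int.cast_ofNat, Int.cast_zero] at w0 w1 w2
  simp only [attachWrite, Program.block_cons, Program.block_nil, Program.run, NatExpr.eval,
    RealExpr.eval, RealExpr.eval_pow, c₁, c₂, w0, w1, w2, b4, a3, a4]
  refine ⟨?_, ?_, ?_, ?_, ?_, ?_, ?_, ?_⟩
  · simp
  · simp [b3]
  · simp
  · simp [nextWidth]
  · simp
  · simp
  · simp [leafWitness]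
  · simp [leafWitness]

/-- The list has the most recently removed leaf at its head, so undoing its last entry is exactly
the situation of `Realizes.attach`: among the vertices already placed, `v` is adjacent to `u` alone.
-/
lemma AttachInv.step {l : List (Fin n × Fin n)} {B : Finset (Fin n)} {s : State}
    (h : AttachInv G l B s) (hl : 0 < s.nvar 3) :
    (∃ l' B', AttachInv G l' B' (attachBody.run s)) ∧ (attachBody.run s).nvar 3 < s.nvar 3 := by
  obtain ⟨hc, hp, hst, hR⟩ := h
  cases hp with
  | nil => rw [hc] at hl; exact absurd hl (lt_irrefl _)
  | @cons l B u v hp hu hv huv honly =>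
    obtain ⟨s4, s5, hst⟩ := hst
    obtain ⟨e0, e3, en, er, r0, r1, r2, r3⟩ := attachBody_run (x := s.vertex u) hc rfl s4 s5 rfl
    have hvert : (attachBody.run s).vertex =
        Function.update s.vertex v (leafPoint (s.rvar 0) (s.vertex u)) := by
      funext w
      rw [State.vertex, r0, r1]
      by_cases hw : w = v
      · subst hw
        simp
      · rw [Function.update_of_ne hw, Function.update_of_ne (Fin.val_ne_of_ne hw),
          Function.update_of_ne (Fin.val_ne_of_ne hw)]
        rfl
    have hwit : (attachBody.run s).witnesses =
        s.witnesses ∪ Set.range (leafWitness (s.rvar 0) (s.vertex u)) := by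
      ext w
      simp only [State.witnesses, Set.mem_ofPred_eq, Set.mem_union, Set.mem_range, e0, r2, r3]
      constructor
      · rintro ⟨j, hj, rfl⟩
        obtain hj | rfl | rfl | rfl : j < s.nvar 0 ∨ j = s.nvar 0 ∨ j = s.nvar 0 + 1 ∨
            j = s.nvar 0 + 2 := by omega
        · left
          refine ⟨j, hj, ?_⟩
          simp [hj.ne, show j ≠ s.nvar 0 + 1 by omega,
            show j ≠ s.nvar 0 + 2 by omega]
        · exact Or.inr ⟨0, by simp⟩
        · exact Or.inr ⟨1, by simp⟩
        · exact Or.inr ⟨2, by simp⟩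
      · rintro (⟨j, hj, rfl⟩ | ⟨i, rfl⟩)
        · refine ⟨j, by omega, ?_⟩
          simp [hj.ne, show j ≠ s.nvar 0 + 1 by omega,
            show j ≠ s.nvar 0 + 2 by omega]
        · refine ⟨s.nvar 0 + i, by omega, ?_⟩
          fin_cases i <;> simp
    refine ⟨⟨l, B, e3, hp, ?_, ?_⟩, ?_⟩
    · rw [en]; exact hst
    · rw [er, hvert, hwit]
      have := hR.attach (u := u) (v := v) (by simpa using ⟨hu, huv.ne⟩) (by simp) huv
        (fun w hw => honly w (Finset.mem_of_mem_erase hw))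
      rwa [← Finset.coe_insert, Finset.insert_erase hv] at this
    · rw [e3, hc, List.length_cons]
      exact Nat.lt_succ_self _

lemma runs_attachLoop {l : List (Fin n × Fin n)} {B : Finset (Fin n)} {s : State}
    (h : AttachInv G l B s) :
    ∃ t s', t ≤ n * ((Test.natLt (.lit 0) (.var 3)).cost + attachBody.time)
      + (Test.natLt (.lit 0) (.var 3)).cost ∧ Runs attachLoop s t s' ∧
      ∃ δ, Realizes G δ Set.univ s'.vertex s'.witnesses := by
  have step : ∀ s, (∃ l B, AttachInv G l B s) → (Test.natLt (.lit 0) (.var 3)).Holds s →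
      (∃ l B, AttachInv G l B (attachBody.run s)) ∧ (attachBody.run s).nvar 3 < s.nvar 3 := by
    rintro s ⟨l, B, hI⟩ hb
    exact hI.step hb
  obtain ⟨t, s', ht, hr, ⟨l', B', hI⟩, hb⟩ := runs_loop (b := .natLt (.lit 0) (.var 3))
    (p := attachBody) (by simp [attachBody, attachRead, attachWrite, Program.LoopFree])
    (fun s => ∃ l B, AttachInv G l B s) (fun s => s.nvar 3) step s ⟨_, _, h⟩
  refine ⟨t, s', ht.trans ?_, hr, s'.rvar 0, ?_⟩
  · gcongr
    have := h.peel.card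
    have := h.cnt
    omega
  -- With no removals left to undo, `Peel` forces the placed set to be everything.
  · obtain rfl : l' = [] := by
      simp only [Test.Holds, NatExpr.eval, hI.cnt, not_lt, nonpos_iff_eq_zero] at hb
      exact List.eq_nil_of_length_eq_zero hb
    have hp := hI.peel
    cases hp
    simpa using hI.real

/-- When the pointer has reached `n`, the invariant `done` covers every vertex, so no leaf is left
and a single vertex remains. It sits at the origin because the real arrays are still zero. -/
lemma PruneInv.attachInv (hG : G.IsTree) (hn : 0 < n) {l : List (Fin n × Fin n)}
    {B : Finset (Fin n)} {s : State} (h : PruneInv G l B s) (hs : s.nvar 1 = n) :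
    AttachInv G l B (initAttach.run s) := by
  obtain ⟨r, hr⟩ := Finset.card_eq_one.1 (h.peel.card_eq_one hG hn fun v hv => by
    rw [← h.deg v hv]
    refine h.done v (hs ▸ v.2.le) ?_
    rw [h.cur_eq hs]
    exact v.2.ne)
  have hδ : UnitFrac (1 / 1000000) :=
    ⟨1000000, le_rfl, by norm_num, by norm_num⟩
  refine ⟨?_, h.peel, ?_, ?_⟩
  · simpa [initAttach, Program.run] using h.cnt
  · simpa [initAttach, Program.run] using h.stored
  · have e1 : (initAttach.run s).rvar 0 = 1 / 1000000 := by
      simp [initAttach, Program.run, RealExpr.eval]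
    have e2 : (initAttach.run s).vertex = fun _ : Fin n => ((0, 0) : ℝ × ℝ) := by
      funext v
      simp [initAttach, Program.run, State.vertex, h.real]
    have e3 : (initAttach.run s).witnesses = ∅ := by
      simp [initAttach, Program.run, State.witnesses, NatExpr.eval]
    rw [e1, e2, e3, hr, Finset.coe_singleton]
    exact realizes_singleton G hδ r

/-- The program realizes every tree in linear time. -/
theorem runs_treeProgram : ∃ C, ∀ (n : ℕ) (G : SimpleGraph (Fin n)), G.IsTree →
    ∀ L : List (Fin n × Fin n), IsEdgeList G L → ∃ t s, t ≤ C * n ∧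
      Runs treeProgram (inputState n L) t s ∧
      ∃ δ, Realizes G δ Set.univ s.vertex s.witnesses := by
  set c₁ := (Test.natLt (.var 1) (.sub (.var 0) (.lit 1))).cost + countBody.time with hc1
  set c₂ := (Test.natLt (.var 1) (.var 0)).cost + pruneBody.time with hc2
  set c₃ := (Test.natLt (.lit 0) (.var 3)).cost + attachBody.time with hc3
  refine ⟨2 * c₁ + 3 * c₂ + 2 * c₃ + (Program.setNat 1 (.lit 0)).time + initAttach.time,
    fun n G hG L hL => ?_⟩
  have hn : 0 < n := by
    have := hL.length_add_one hG
    omega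
  obtain ⟨t₁, s₁, ht₁, hr₁, h₁, hs₁⟩ := runs_countLoop hG hL
  have hf₁ : (Program.setNat 1 (.lit 0)).LoopFree := trivial
  obtain ⟨t₂, ht₂, hr₂⟩ := hf₁.runs s₁
  obtain ⟨t₃, s₃, l, B, ht₃, hr₃, h₃, hs₃⟩ := runs_pruneLoop hn (h₁.pruneInv hL hn hs₁)
    (by simp [Program.run, NatExpr.eval])
  have hf₃ : initAttach.LoopFree := by simp [initAttach, Program.LoopFree]
  obtain ⟨t₄, ht₄, hr₄⟩ := hf₃.runs s₃
  obtain ⟨t₅, s₅, ht₅, hr₅, h₅⟩ := runs_attachLoop (h₃.attachInv hG hn hs₃)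
  refine ⟨_, s₅, ?_, .seq hr₁ (.seq hr₂ (.seq hr₃ (.seq hr₄ hr₅))), h₅⟩
  rw [← hc1] at ht₁
  rw [← hc2] at ht₃
  rw [← hc3] at ht₅
  have b₁ : (Test.natLt (.var 1) (.sub (.var 0) (.lit 1))).cost ≤ c₁ := Nat.le_add_right _ _
  have b₂ : (Test.natLt (.var 1) (.var 0)).cost ≤ c₂ := Nat.le_add_right _ _
  have b₃ : (Test.natLt (.lit 0) (.var 3)).cost ≤ c₃ := Nat.le_add_right _ _
  clear_value c₁ c₂ c₃
  generalize (Program.setNat 1 (.lit 0)).time = c₄ at *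
  generalize initAttach.time = c₅ at *
  -- A tree has at least one vertex, so additive constants are absorbed into the linear term.
  have k : ∀ c, c ≤ c * n := fun c => Nat.le_mul_of_pos_right c hn
  have := k c₁
  have := k c₂
  have := k c₃
  have := k c₄
  have := k c₅
  calc _ ≤ (n * c₁ + c₁) + (c₄ + ((2 * n * c₂ + c₂) + (c₅ + (n * c₃ + c₃)))) := by omega
    _ ≤ (n * c₁ + c₁ * n) + (c₄ * n + ((2 * n * c₂ + c₂ * n) + (c₅ * n + (n * c₃ + c₃ * n)))) := by
      omega
    _ = _ := by ring

end RealRAM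

/-! ### Back to the Euclidean plane -/

/-- The point of the Euclidean plane with the given coordinates. -/
noncomputable def toPlane (a : ℝ × ℝ) : Plane := !₂[a.1, a.2]

@[simp] lemma toPlane_zero (a : ℝ × ℝ) : toPlane a 0 = a.1 := by simp [toPlane]

@[simp] lemma toPlane_one (a : ℝ × ℝ) : toPlane a 1 = a.2 := by simp [toPlane]

lemma toPlane_injective : Function.Injective toPlane := by
  intro a b h
  exact Prod.ext (by rw [← toPlane_zero a, h, toPlane_zero])
    (by rw [← toPlane_one a, h, toPlane_one])

lemma sq_dist_toPlane (a : ℝ × ℝ) (c : Plane) : dist (toPlane a) c ^ 2 = sqDist (c 0, c 1) a := by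
  rw [EuclideanSpace.dist_sq_eq, Fin.sum_univ_two, Real.dist_eq, Real.dist_eq, sq_abs, sq_abs,
    toPlane_zero, toPlane_one, sqDist]
  ring

lemma orient_eq_zero_of_collinear {a b c : ℝ × ℝ}
    (h : Collinear ℝ ({toPlane a, toPlane b, toPlane c} : Set Plane)) : orient a b c = 0 := by
  rw [collinear_iff_of_mem (p₀ := toPlane a) (by simp)] at h
  obtain ⟨v, hv⟩ := h
  obtain ⟨r, hr⟩ := hv (toPlane b) (by simp)
  obtain ⟨t, ht⟩ := hv (toPlane c) (by simp)
  have r0 := congrFun (congrArg WithLp.ofLp hr) 0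
  have r1 := congrFun (congrArg WithLp.ofLp hr) 1
  have t0 := congrFun (congrArg WithLp.ofLp ht) 0
  have t1 := congrFun (congrArg WithLp.ofLp ht) 1
  simp at r0 r1 t0 t1
  rw [orient, r0, r1, t0, t1]
  ring

/-- The determinant does not change when the squared distances to `a` are replaced by squared
distances to any `z` minus that of `a`, because the linear terms cancel. For `z` the centre of the
circle these differences vanish. -/
lemma incirc_eq_zero_of_concyclic {a b c d : ℝ × ℝ}
    (h : EuclideanGeometry.Concyclic
      ({toPlane a, toPlane b, toPlane c, toPlane d} : Set Plane)) : incirc a b c d = 0 := by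
  obtain ⟨⟨z, r, hz⟩, -⟩ := h
  have key : ∀ x, toPlane x ∈ ({toPlane a, toPlane b, toPlane c, toPlane d} : Set Plane) →
      sqDist (z 0, z 1) x = r ^ 2 := fun x hx => by
    rw [← sq_dist_toPlane, hz _ hx]
  have ka := key a (by simp)
  have kb := key b (by simp)
  have kc := key c (by simp)
  have kd := key d (by simp)
  simp only [sqDist] at ka kb kc kd
  simp only [incirc, orient]
  linear_combination ((b.1 - a.1) * (c.2 - a.2) - (b.2 - a.2) * (c.1 - a.1)) * (kd - ka)
    - ((b.1 - a.1) * (d.2 - a.2) - (b.2 - a.2) * (d.1 - a.1)) * (kc - ka)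
    + ((c.1 - a.1) * (d.2 - a.2) - (c.2 - a.2) * (d.1 - a.1)) * (kb - ka)

lemma GenPos.inGeneralPosition {S : Set (ℝ × ℝ)} (h : GenPos S) :
    InGeneralPosition (toPlane '' S) := by
  constructor
  · rintro _ ⟨a, ha, rfl⟩ _ ⟨b, hb, rfl⟩ _ ⟨c, hc, rfl⟩ hab hac hbc hcol
    exact h.line a ha b hb c hc (ne_of_apply_ne _ hab) (ne_of_apply_ne _ hac)
      (ne_of_apply_ne _ hbc) (orient_eq_zero_of_collinear hcol)
  · rintro _ ⟨a, ha, rfl⟩ _ ⟨b, hb, rfl⟩ _ ⟨c, hc, rfl⟩ _ ⟨d, hd, rfl⟩ hab hac had hbc hbd hcd hcon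
    exact h.circle a ha b hb c hc d hd (ne_of_apply_ne _ hab) (ne_of_apply_ne _ hac)
      (ne_of_apply_ne _ had) (ne_of_apply_ne _ hbc) (ne_of_apply_ne _ hbd)
      (ne_of_apply_ne _ hcd) (incirc_eq_zero_of_concyclic hcon)

/-- In a realization of a whole graph, adjacency is witness Delaunay adjacency. -/
lemma Realizes.adj_iff {V : Type*} {G : SimpleGraph V} {δ : ℝ} {p : V → ℝ × ℝ}
    {W : Set (ℝ × ℝ)} (h : Realizes G δ Set.univ p W) (u v : V) :
    G.Adj u v ↔ toPlane (p u) ≠ toPlane (p v) ∧ ∃ (c : Plane) (r : ℝ),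
      toPlane (p u) ∈ Metric.sphere c r ∧ toPlane (p v) ∈ Metric.sphere c r ∧
      ∀ w ∈ toPlane '' W, w ∉ Metric.ball c r := by
  constructor
  · intro hadj
    obtain ⟨c, -, hD⟩ := h.edge u trivial v trivial hadj
    refine ⟨fun e => hadj.ne (h.injOn trivial trivial (toPlane_injective e)), toPlane c,
      dist (toPlane (p u)) (toPlane c), rfl, ?_, ?_⟩
    · rw [Metric.mem_sphere, ← sq_eq_sq₀ dist_nonneg dist_nonneg, sq_dist_toPlane,
        sq_dist_toPlane]
      simpa using hD.eq.symm
    · rintro _ ⟨w, hw, rfl⟩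
      rw [Metric.mem_ball, not_lt, ← sq_le_sq₀ dist_nonneg dist_nonneg, sq_dist_toPlane,
        sq_dist_toPlane, toPlane_zero, toPlane_one]
      -- A witness that coincided with an end of the edge would lie on the circle, hence not in the
      -- open disk.
      by_cases h1 : w = p u
      · rw [h1]
      · by_cases h2 : w = p v
        · rw [h2]; exact hD.eq.le
        · exact (hD.empty w (Or.inr hw) h1 h2).le
  · rintro ⟨hne, c, r, hu, hv, hW⟩
    by_contra hadj
    rw [Metric.mem_sphere] at hu hv
    obtain ⟨w, hw, hlt⟩ := h.nonedge u trivial v trivial (fun e => hne (by rw [e])) hadj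
      (c 0, c 1) (by rw [← sq_dist_toPlane, ← sq_dist_toPlane, hu, hv])
    apply hW _ ⟨w, hw, rfl⟩
    rwa [← sq_dist_toPlane, ← sq_dist_toPlane, sq_lt_sq₀ dist_nonneg dist_nonneg, hu] at hlt

lemma outputWitnesses_eq (s : RealRAM.State) : outputWitnesses s = toPlane '' s.witnesses := by
  ext w
  constructor
  · rintro ⟨j, hj, rfl⟩
    exact ⟨_, ⟨j, hj, rfl⟩, rfl⟩
  · rintro ⟨_, ⟨j, hj, rfl⟩, rfl⟩
    exact ⟨j, hj, rfl⟩

lemma finite_outputWitnesses (s : RealRAM.State) : (outputWitnesses s).Finite := by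
  refine ((Set.finite_lt_nat (s.nvar 0)).image fun j => !₂[s.rarr 2 j, s.rarr 3 j]).subset ?_
  rintro w ⟨j, hj, rfl⟩
  exact ⟨j, hj, rfl⟩

lemma Realizes.output {n : ℕ} {G : SimpleGraph (Fin n)} {δ : ℝ} {s : RealRAM.State}
    (h : Realizes G δ Set.univ s.vertex s.witnesses) :
    InGeneralPosition (Set.range (fun v : Fin n => outputVertex s v) ∪ outputWitnesses s) ∧
      ∃ φ : G ≃g witnessDelaunay (Set.range (fun v : Fin n => outputVertex s v))
        (outputWitnesses s), ∀ v : Fin n, (φ v : Plane) = outputVertex s v := by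
  have hinj : Function.Injective fun v : Fin n => outputVertex s v := fun u v huv =>
    h.injOn trivial trivial (toPlane_injective huv)
  constructor
  · have := h.genPos.inGeneralPosition
    rwa [Set.image_union, Set.image_univ, ← Set.range_comp, ← outputWitnesses_eq] at this
  · refine ⟨⟨Equiv.ofInjective _ hinj, ?_⟩, fun v => rfl⟩
    intro u v
    rw [h.adj_iff u v, ← outputWitnesses_eq]
    exact and_congr_left' (not_congr Subtype.ext_iff)

lemma exists_isEdgeList {n : ℕ} (G : SimpleGraph (Fin n)) :
    ∃ L : List (Fin n × Fin n), IsEdgeList G L := by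
  classical
  refine ⟨G.edgeFinset.toList.map Quot.out, ?_⟩
  have e : (G.edgeFinset.toList.map Quot.out).map (fun e : Fin n × Fin n => s(e.1, e.2)) =
      G.edgeFinset.toList := by
    rw [List.map_map]
    exact (List.map_congr_left fun e _ => Quot.out_eq e).trans (List.map_id _)
  rw [IsEdgeList, e]
  exact ⟨Finset.nodup_toList _, fun e => by simp⟩

theorem mainTheorem2 :
    (∀ (V : Type*) [Finite V] (G : SimpleGraph V), G.IsTree →
      ∃ P W : Finset Plane, InGeneralPosition (P ∪ W : Set Plane) ∧
        Nonempty (G ≃g witnessDelaunay (P : Set Plane) (W : Set Plane))) ∧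
    (∃ (prog : RealRAM.Program) (C : ℕ),
      ∀ (n : ℕ) (G : SimpleGraph (Fin n)), G.IsTree →
        ∀ L : List (Fin n × Fin n), IsEdgeList G L →
          ∃ (t : ℕ) (s : RealRAM.State), t ≤ C * n ∧
            RealRAM.Runs prog (inputState n L) t s ∧
            InGeneralPosition
              (Set.range (fun v : Fin n => outputVertex s v) ∪ outputWitnesses s) ∧
            ∃ φ : G ≃g witnessDelaunay (Set.range (fun v : Fin n => outputVertex s v))
                (outputWitnesses s),
              ∀ v : Fin n, (φ v : Plane) = outputVertex s v) := by
  obtain ⟨C, hC⟩ := RealRAM.runs_treeProgram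
  constructor
  · intro V _ G hG
    -- Existence follows from the algorithm, run on a copy of the tree with vertices `0, …, n - 1`
    -- and any list of its edges.
    obtain ⟨n, ⟨e⟩⟩ := Finite.exists_equiv_fin V
    let f : G ≃g G.map e.toEmbedding := SimpleGraph.Iso.map e G
    obtain ⟨L, hL⟩ := exists_isEdgeList (G.map e.toEmbedding)
    obtain ⟨t, s, -, -, δ, hR⟩ := hC n _ (f.isTree_iff.1 hG) L hL
    obtain ⟨hgp, φ, -⟩ := hR.output
    obtain ⟨P, hP⟩ := (Set.finite_range fun v : Fin n => outputVertex s v).exists_finset_coe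
    obtain ⟨W, hW⟩ := (finite_outputWitnesses s).exists_finset_coe
    refine ⟨P, W, ?_, ?_⟩ <;> rw [hP, hW]
    · exact hgp
    · exact ⟨f.trans φ⟩
  · refine ⟨RealRAM.treeProgram, C, fun n G hG L hL => ?_⟩
    obtain ⟨t, s, ht, hr, δ, hR⟩ := hC n G hG L hL
    exact ⟨t, s, ht, hr, hR.output⟩
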